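/- Let $0<q<1$, and write $(a;q)_n=\prod_{j=0}^{n-1}(1-aq^j)$, $(a;q)_\infty=\prod_{j\ge 0}(1-aq^j)$, $(a_1,\dots,a_m;q)_n=\prod_{i=1}^m (a_i;q)_n$ for $n\in\{0,1,2,\dots\}\cup\{\infty\}$, and $${}_3\phi_2\Big[\begin{array}{c} a,\ b,\ c\\ d,\ e\end{array};\ q,\ z\Big]=\sum_{k=0}^\infty \frac{(a,b,c;q)_k}{(q,d,e;q)_k}\,z^k .$$ Let $\alpha\in\mathbb{R}$, $\beta>0$, $\xi<0$ with $\alpha\xi\notin\{q^{-n}:n=0,1,2,\dots\}$ (so that the series below has no zero denominators), and let $u\in\mathbb{C}$ with $\mathrm{Re}\,u<0$. Then $$\frac{(\alpha u,\alpha/u;q)_\infty}{(\beta u,\beta/u;q)_\infty}=\frac{(\alpha\xi,\alpha/\xi;q)_\infty}{(\beta\xi,\beta/\xi;q)_\infty}\;{}_3\phi_2\Big[\begin{array}{c}\alpha/\beta,\ \xi u,\ \xi/u\\ \alpha\xi,\ q\xi/\beta\end{array};\ q,\ q\Big]+\frac{1}{4\pi i}\int_{-i\infty}^{i\infty}\frac{(\alpha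 v,\alpha/v,\xi u,\xi/u;q)_\infty}{(\beta v,\beta/v,\xi v,\xi/v;q)_\infty}\,\frac{(1-v^2)\,u}{(u-v)(uv-1)\,v}\,dv,$$ where the series and the integral (along the imaginary axis, upwards) both converge absolutely. -/

import Mathlib

namespace QSeries

/-- The finite `q`-shifted factorial `(a; q)_n = ∏_{j < n} (1 - a q^j)`. -/
noncomputable def qPoch (a q : ℂ) (n : ℕ) : ℂ :=
  ∏ j ∈ Finset.range n, (1 - a * q ^ j)

/-- The infinite `q`-shifted factorial `(a; q)_∞ = ∏_{j ≥ 0} (1 - a q^j)`, for `|q| < 1`. -/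
noncomputable def qPochInf (a q : ℂ) : ℂ :=
  ∏' j : ℕ, (1 - a * q ^ j)

/-- The product defining `(a; q)_∞` converges for `|q| < 1`. -/
theorem multipliable_qPochInf (a : ℂ) {q : ℂ} (hq : ‖q‖ < 1) :
    Multipliable fun j : ℕ => 1 - a * q ^ j := by
  have h : Summable fun j : ℕ => ‖-(a * q ^ j)‖ := by
    simpa [norm_mul, norm_pow] using
      (summable_geometric_of_lt_one (norm_nonneg q) hq).mul_left ‖a‖
  simpa [sub_eq_add_neg] using multipliable_one_add_of_summable h

/-- The `k`-th term `(a, b, c; q)_k / (q, d, e; q)_k * z^k` of the basic hypergeometric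
series `₃φ₂`. -/
noncomputable def phi32Term (a b c d e q z : ℂ) (k : ℕ) : ℂ :=
  (qPoch a q k * qPoch b q k * qPoch c q k) /
    (qPoch q q k * qPoch d q k * qPoch e q k) * z ^ k

/-- The basic hypergeometric series `₃φ₂[a, b, c; d, e; q, z]`. -/
noncomputable def phi32 (a b c d e q z : ℂ) : ℂ :=
  ∑' k : ℕ, phi32Term a b c d e q z k

/-- Absolute convergence of the contour integral of `F` along the imaginary axis. -/
def IntegrableOnImagAxis (F : ℂ → ℂ) : Prop :=
  MeasureTheory.Integrable fun s : ℝ => F (s * Complex.I)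

/-- The contour integral `∫_{-i∞}^{i∞} F(v) dv`, parametrized by `v = i s`, `s ∈ ℝ`. -/
noncomputable def imagAxisIntegral (F : ℂ → ℂ) : ℂ :=
  ∫ s : ℝ, F (s * Complex.I) * Complex.I

/-- The integrand
`(α v, α/v, ξ u, ξ/u; q)_∞ / (β v, β/v, ξ v, ξ/v; q)_∞ * (1 - v²) u / ((u - v) (u v - 1) v)`. -/
noncomputable def remainderIntegrand (q α β ξ u v : ℂ) : ℂ :=
  (qPochInf (α * v) q * qPochInf (α / v) q * qPochInf (ξ * u) q * qPochInf (ξ / u) q) /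
    (qPochInf (β * v) q * qPochInf (β / v) q * qPochInf (ξ * v) q * qPochInf (ξ / v) q) *
    (((1 - v ^ 2) * u) / ((u - v) * (u * v - 1) * v))

end QSeries

/-! Write f for the quotient on the left, ω_N(v) = (ξv, ξ/v; q)_N, K for the rational kernel, and
P_N for the N-th partial sum of the series with its prefactor. The function f is invariant under v ↦
1/v and, as β > 0, analytic off [0, ∞). At v = ξqⁿ with n < N the sum P_N contains the whole
terminating series, and there f and P_N obey the same first-order recurrence in n, a form of the
q-Pfaff–Saalschütz sum (`partialExpansion_node`). By symmetry P_N also interpolates f at the inverse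
nodes. If all these nodes are distinct, f - P_N = ω_N g with g analytic off [0, ∞)
(`exists_thetaQuot_sub_eq`).

In the left half plane f grows at most like |v|^m once |α|q^m ≤ β, so for N ≥ m + 2 the function g
is O(1/v) at infinity. Cauchy's formula with the kernel K then expresses 2π(g(u) + g(1/u)) = 4πg(u)
as the integral of gK over the imaginary axis (`cauchy_symmKernel`). The part P_N/ω_N of g
contributes nothing: its poles are negative, so the contour closes in the right half plane
(`integral_symmKernel_div_nodePoly`). What remains is the expansion of f with remainder integrand
(f/ω_N)K.

On the imaginary axis |ω_N| ≥ 1, and |ω_N| increases with |ξ| and with N. Dominated convergence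
therefore removes the distinctness assumption by moving ξ (`thetaQuot_eq_partialExpansion_add`), and
then lets N tend to infinity. -/

namespace QSeries

open Filter Topology

/-! ### Finite and infinite q-shifted factorials -/

lemma qPoch_zero (a q : ℂ) : qPoch a q 0 = 1 := by simp [qPoch]

lemma qPoch_succ (a q : ℂ) (n : ℕ) : qPoch a q (n + 1) = qPoch a q n * (1 - a * q ^ n) := by
  simp [qPoch, Finset.prod_range_succ]

lemma qPoch_succ' (a q : ℂ) (n : ℕ) : qPoch a q (n + 1) = (1 - a) * qPoch (a * q) q n := by
  simp only [qPoch, Finset.prod_range_succ', pow_zero, mul_one]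
  rw [mul_comm]
  congr 1
  exact Finset.prod_congr rfl fun j _ => by ring

lemma qPoch_add (a q : ℂ) (m n : ℕ) :
    qPoch a q (m + n) = qPoch a q m * qPoch (a * q ^ m) q n := by
  simp only [qPoch, Finset.prod_range_add]
  congr 1
  exact Finset.prod_congr rfl fun j _ => by ring

lemma qPoch_ne_zero {a q : ℂ} (h : ∀ j : ℕ, a * q ^ j ≠ 1) (n : ℕ) : qPoch a q n ≠ 0 :=
  Finset.prod_ne_zero_iff.2 fun j _ => sub_ne_zero.2 (h j).symm

lemma qPoch_eq_zero {a q : ℂ} {j n : ℕ} (hj : j < n) (h : a * q ^ j = 1) : qPoch a q n = 0 :=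
  Finset.prod_eq_zero (Finset.mem_range.2 hj) (by rw [h, sub_self])

@[fun_prop]
lemma continuous_qPoch (q : ℂ) (n : ℕ) : Continuous fun a => qPoch a q n := by
  unfold qPoch; fun_prop

lemma tendsto_qPoch (a : ℂ) {q : ℂ} (hq : ‖q‖ < 1) :
    Tendsto (fun n => qPoch a q n) atTop (𝓝 (qPochInf a q)) :=
  (multipliable_qPochInf a hq).tendsto_prod_tprod_nat

lemma qPochInf_eq_qPoch_mul (a : ℂ) {q : ℂ} (hq : ‖q‖ < 1) (m : ℕ) :
    qPochInf a q = qPoch a q m * qPochInf (a * q ^ m) q := by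
  refine tendsto_nhds_unique ((tendsto_qPoch a hq).comp (tendsto_add_atTop_nat m)) ?_
  have := (tendsto_qPoch (a * q ^ m) hq).const_mul (qPoch a q m)
  refine this.congr fun n => ?_
  simp only [Function.comp]
  rw [add_comm n m, qPoch_add]

lemma qPochInf_eq_one_sub_mul (a : ℂ) {q : ℂ} (hq : ‖q‖ < 1) :
    qPochInf a q = (1 - a) * qPochInf (a * q) q := by
  simpa [qPoch] using qPochInf_eq_qPoch_mul a hq 1

lemma summable_norm_mul_pow (a : ℂ) {q : ℂ} (hq : ‖q‖ < 1) :
    Summable fun j : ℕ => ‖-(a * q ^ j)‖ := by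
  simpa [norm_mul, norm_pow] using
    (summable_geometric_of_lt_one (norm_nonneg q) hq).mul_left ‖a‖

lemma qPochInf_ne_zero {a q : ℂ} (hq : ‖q‖ < 1) (h : ∀ j : ℕ, a * q ^ j ≠ 1) :
    qPochInf a q ≠ 0 := by
  have := tprod_one_add_ne_zero_of_summable (f := fun j : ℕ => -(a * q ^ j))
    (fun j => by rw [← sub_eq_add_neg]; exact sub_ne_zero.2 (h j).symm)
    (summable_norm_mul_pow a hq)
  simpa [qPochInf, sub_eq_add_neg] using this

lemma differentiable_qPochInf {q : ℂ} (hq : ‖q‖ < 1) :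
    Differentiable ℂ fun a => qPochInf a q := by
  intro a₀
  have hprod : HasProdLocallyUniformlyOn (fun (j : ℕ) (a : ℂ) => 1 + -(a * q ^ j))
      (fun a => ∏' j : ℕ, (1 + -(a * q ^ j))) (Metric.ball 0 (‖a₀‖ + 1)) := by
    refine Summable.hasProdLocallyUniformlyOn_nat_one_add (u := fun j => (‖a₀‖ + 1) * ‖q‖ ^ j)
      Metric.isOpen_ball ((summable_geometric_of_lt_one (norm_nonneg q) hq).mul_left _)
      (.of_forall fun n a ha => ?_) fun n => by fun_prop
    rw [norm_neg, norm_mul, norm_pow]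
    have : ‖a‖ < ‖a₀‖ + 1 := by simpa using ha
    gcongr
  have hd : DifferentiableOn ℂ (fun a => ∏' j : ℕ, (1 + -(a * q ^ j)))
      (Metric.ball 0 (‖a₀‖ + 1)) :=
    hprod.differentiableOn (.of_forall fun _ => by
      simpa [Finset.prod_fn] using DifferentiableOn.finsetProd (fun _ _ => by fun_prop))
      Metric.isOpen_ball
  have := hd.differentiableAt (Metric.isOpen_ball.mem_nhds (x := a₀) (by simp))
  simpa [qPochInf, sub_eq_add_neg] using this

lemma continuous_qPochInf {q : ℂ} (hq : ‖q‖ < 1) : Continuous fun a => qPochInf a q :=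
  (differentiable_qPochInf hq).continuous

/-! ### Growth of q-products in the left half plane -/

section Comparison

variable {q : ℝ}

/-- The difference of the squared norms is (b² - a²)|v|² - 2(b - a) Re v, and both parts are
nonnegative. Every estimate of q-products below rests on this factorwise comparison. -/
lemma norm_one_sub_mul_le {a b : ℝ} (hab : |a| ≤ b) {v : ℂ} (hv : v.re ≤ 0) :
    ‖1 - (a : ℂ) * v‖ ≤ ‖1 - (b : ℂ) * v‖ := by
  rw [Complex.norm_def, Complex.norm_def]
  apply Real.sqrt_le_sqrt
  have h1 : a ^ 2 ≤ b ^ 2 := sq_le_sq' (by linarith [neg_abs_le a]) ((le_abs_self a).trans hab)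
  have h2 : a ≤ b := (le_abs_self a).trans hab
  simp only [Complex.normSq_apply, Complex.sub_re, Complex.one_re, Complex.sub_im, Complex.one_im,
    Complex.mul_re, Complex.mul_im, Complex.ofReal_re, Complex.ofReal_im]
  nlinarith [mul_nonneg (sub_nonneg.2 h1) (add_nonneg (mul_self_nonneg v.re)
    (mul_self_nonneg v.im)), mul_nonneg (sub_nonneg.2 h2) (neg_nonneg.2 hv)]

lemma norm_qPoch_mul_le (hq0 : 0 < q) {a b : ℝ} (hab : |a| ≤ b) {v : ℂ} (hv : v.re ≤ 0) (n : ℕ) :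
    ‖qPoch (a * v) q n‖ ≤ ‖qPoch (b * v) q n‖ := by
  simp only [qPoch, norm_prod]
  refine Finset.prod_le_prod (fun _ _ => norm_nonneg _) fun j _ => ?_
  have h : |a * q ^ j| ≤ b * q ^ j := by
    rw [abs_mul, abs_of_pos (pow_pos hq0 j)]
    gcongr
  have := norm_one_sub_mul_le h hv
  push_cast at this
  rwa [mul_right_comm, mul_right_comm (b : ℂ)]

lemma norm_ofReal_lt_one (hq0 : 0 < q) (hq1 : q < 1) : ‖(q : ℂ)‖ < 1 := by
  rwa [Complex.norm_real, Real.norm_of_nonneg hq0.le]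

lemma norm_qPochInf_mul_le (hq0 : 0 < q) (hq1 : q < 1) {a b : ℝ} (hab : |a| ≤ b) {v : ℂ}
    (hv : v.re ≤ 0) : ‖qPochInf (a * v) q‖ ≤ ‖qPochInf (b * v) q‖ :=
  le_of_tendsto_of_tendsto' (tendsto_qPoch _ (norm_ofReal_lt_one hq0 hq1)).norm
    (tendsto_qPoch _ (norm_ofReal_lt_one hq0 hq1)).norm fun n => norm_qPoch_mul_le hq0 hab hv n

lemma norm_qPoch_le (hq0 : 0 < q) (hq1 : q < 1) (a : ℂ) (n : ℕ) :
    ‖qPoch a q n‖ ≤ (1 + ‖a‖) ^ n := by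
  simp only [qPoch, norm_prod]
  refine (Finset.prod_le_prod (g := fun _ => 1 + ‖a‖) (fun _ _ => norm_nonneg _)
    fun j _ => ?_).trans (by simp)
  refine (norm_sub_le _ _).trans ?_
  rw [norm_one, norm_mul, norm_pow]
  gcongr
  exact mul_le_of_le_one_right (norm_nonneg _)
    (pow_le_one₀ (norm_nonneg _) (norm_ofReal_lt_one hq0 hq1).le)

/-- In the left half plane, the quotient `(α v; q)_∞ / (β v; q)_∞` grows at most polynomially. -/
lemma norm_qPochInf_div_le (hq0 : 0 < q) (hq1 : q < 1) {α β : ℝ} {m : ℕ} (hm : |α * q ^ m| ≤ β)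
    {v : ℂ} (hv : v.re ≤ 0) :
    ‖qPochInf (α * v) q / qPochInf (β * v) q‖ ≤ (1 + |α| * ‖v‖) ^ m := by
  have hq := norm_ofReal_lt_one hq0 hq1
  -- After m factors are split off, the remaining numerator has parameter αq^m and is dominated by
  -- the denominator; the m factors give the polynomial bound.
  rw [qPochInf_eq_qPoch_mul (α * v) hq m, mul_div_assoc, norm_mul, norm_div]
  have h1 : ‖qPochInf (α * v * (q : ℂ) ^ m) q‖ / ‖qPochInf (β * v) q‖ ≤ 1 := by
    refine div_le_one_of_le₀ ?_ (norm_nonneg _)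
    have := norm_qPochInf_mul_le hq0 hq1 hm hv
    push_cast at this
    rwa [mul_right_comm]
  have h2 := norm_qPoch_le hq0 hq1 (α * v) m
  rw [norm_mul, Complex.norm_real, Real.norm_eq_abs] at h2
  calc _ ≤ (1 + |α| * ‖v‖) ^ m * 1 := by gcongr
    _ = _ := mul_one _

lemma exists_abs_mul_pow_le (hq0 : 0 < q) (hq1 : q < 1) (α : ℝ) {β : ℝ} (hβ : 0 < β) :
    ∃ m : ℕ, |α * q ^ m| ≤ β := by
  have : Tendsto (fun m : ℕ => |α * q ^ m|) atTop (𝓝 0) := by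
    simpa using ((tendsto_pow_atTop_nhds_zero_of_lt_one hq0.le hq1).const_mul α).abs
  exact (this.eventually (ge_mem_nhds hβ)).exists

end Comparison

/-! ### The symmetric quotient and its interpolation at the nodes ξqⁿ -/

/-- The quotient `(α v, α/v; q)_∞ / (β v, β/v; q)_∞`. -/
noncomputable def thetaQuot (q α β v : ℂ) : ℂ :=
  (qPochInf (α * v) q * qPochInf (α / v) q) / (qPochInf (β * v) q * qPochInf (β / v) q)

lemma thetaQuot_inv (q α β v : ℂ) : thetaQuot q α β v⁻¹ = thetaQuot q α β v := by
  simp only [thetaQuot, div_inv_eq_mul, ← div_eq_mul_inv]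
  ring

/-- The product `(a v, a/v; q)_n`. -/
noncomputable def nodePoly (q a : ℂ) (n : ℕ) (v : ℂ) : ℂ := qPoch (a * v) q n * qPoch (a / v) q n

lemma nodePoly_inv (q a : ℂ) (n : ℕ) (v : ℂ) : nodePoly q a n v⁻¹ = nodePoly q a n v := by
  simp only [nodePoly, div_inv_eq_mul, ← div_eq_mul_inv]
  ring

/-- The first-order recurrence in `y = q^n` behind the `q`-Pfaff–Saalschütz summation, in
telescoped form. -/
lemma sum_sub_mul_sum_eq {q α β ξ y : ℂ} (hq : ∀ j : ℕ, q * q ^ j ≠ 1) (hq0 : q ≠ 0) (hy : y ≠ 0)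
    (hβ : β ≠ 0) (hξ : ξ ≠ 0) (hd : ∀ j : ℕ, α * ξ * q ^ j ≠ 1)
    (he : ∀ j : ℕ, q * ξ / β * q ^ j ≠ 1) (hdy : α * ξ * y ≠ 1) (hey : q * ξ * y ≠ β) (K : ℕ) :
    ∑ k ∈ Finset.range (K + 1),
        (phi32Term (α / β) (ξ * (ξ * (y * q))) (ξ / (ξ * (y * q))) (α * ξ) (q * ξ / β) q q k -
          (ξ * y * q - α) * (1 - β * ξ * y) / ((1 - α * ξ * y) * (ξ * y * q - β)) *
            phi32Term (α / β) (ξ * (ξ * y)) (ξ / (ξ * y)) (α * ξ) (q * ξ / β) q q k) =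
      (1 - ξ ^ 2 * y ^ 2 * q) / ((1 - α * ξ * y) * (1 - q * ξ / β * y)) *
        (qPoch (α / β) q (K + 1) * qPoch (ξ ^ 2 * y * q) q K * qPoch y⁻¹ q K /
          (qPoch q q K * qPoch (α * ξ) q K * qPoch (q * ξ / β) q K)) := by
  have e1 : ξ * (ξ * (y * q)) = ξ ^ 2 * y * q := by ring
  have e2 : ξ / (ξ * (y * q)) = (y * q)⁻¹ := by field_simp
  have e3 : ξ * (ξ * y) = ξ ^ 2 * y := by ring
  have e4 : ξ / (ξ * y) = y⁻¹ := by field_simp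
  rw [e1, e2, e3, e4]
  have h1 : 1 - α * ξ * y ≠ 0 := sub_ne_zero.2 hdy.symm
  have h2 : ξ * y * q - β ≠ 0 := sub_ne_zero.2 (by convert hey using 1; ring)
  have h2' : β - ξ * y * q ≠ 0 := by rw [← neg_ne_zero, neg_sub]; exact h2
  -- The right side is a guessed antidifference in K, so induction leaves one rational identity.
  -- Naming the denominators lets them be cleared before they are expanded again.
  induction K with
  | zero =>
    simp only [Nat.zero_add, Finset.sum_range_one, phi32Term, qPoch_zero, qPoch_succ, pow_zero]
    have h3 : 1 - q * ξ / β * y = (β - ξ * y * q) / β := by field_simp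
    rw [h3]
    have h4 : ξ * y * q - β = -(β - ξ * y * q) := by ring
    rw [h4]
    generalize hX : 1 - α * ξ * y = X at *
    generalize hY : β - ξ * y * q = Y at *
    field_simp
    rw [← hX, ← hY]
    ring
  | succ K ih =>
    rw [Finset.sum_range_succ, ih]
    have n1 := qPoch_ne_zero hq K
    have n2 := qPoch_ne_zero hd K
    have n3 := qPoch_ne_zero he K
    have m1 : 1 - q * q ^ K ≠ 0 := sub_ne_zero.2 (hq K).symm
    have m2 : 1 - α * ξ * q ^ K ≠ 0 := sub_ne_zero.2 (hd K).symm
    have m3 : 1 - q * ξ / β * q ^ K ≠ 0 := sub_ne_zero.2 (he K).symm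
    have m3' : β - q * ξ * q ^ K ≠ 0 := by
      intro h; apply m3; field_simp; linear_combination h
    have k1 : qPoch (ξ ^ 2 * y) q (K + 1) = (1 - ξ ^ 2 * y) * qPoch (ξ ^ 2 * y * q) q K :=
      qPoch_succ' _ _ _
    have k2 : qPoch (y * q)⁻¹ q (K + 1) = (1 - (y * q)⁻¹) * qPoch y⁻¹ q K := by
      rw [qPoch_succ']; congr 2; field_simp
    simp only [phi32Term, k1, k2]
    simp only [qPoch_succ (α / β) q (K + 1), qPoch_succ _ q K]
    generalize qPoch (ξ ^ 2 * y * q) q K = A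
    generalize qPoch y⁻¹ q K = B
    generalize qPoch (α / β) q K = C
    generalize qPoch q q K = D at *
    generalize qPoch (α * ξ) q K = E at *
    generalize qPoch (q * ξ / β) q K = F at *
    have h3 : 1 - q * ξ / β * y = (β - ξ * y * q) / β := by field_simp
    have h5 : 1 - q * ξ / β * q ^ K = (β - q * ξ * q ^ K) / β := by field_simp
    have h4 : ξ * y * q - β = -(β - ξ * y * q) := by ring
    rw [h3, h5, h4, pow_succ q K]
    generalize q ^ K = z at *
    clear k1 k2 ih h3 h4 h5 m3 he hey hdy
    generalize hX : 1 - α * ξ * y = X at *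
    generalize hY : β - ξ * y * q = Y at *
    generalize hZ : 1 - q * z = Z at *
    generalize hW : 1 - α * ξ * z = W at *
    generalize hV : β - q * ξ * z = V at *
    field_simp
    rw [← hX, ← hY, ← hZ, ← hW, ← hV]
    ring

/-- A shift by q changes each infinite product by one factor. At v = ξy the ratio is the multiplier
in `sum_sub_mul_sum_eq`, so the quotient and the sum satisfy the same recurrence. -/
lemma thetaQuot_mul_q {q α β v : ℂ} (hq : ‖q‖ < 1) (hq0 : q ≠ 0) (hv : v ≠ 0)
    (h1 : α * v ≠ 1) (h2 : β * v ≠ 1) (h3 : v * q ≠ β) :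
    thetaQuot q α β (v * q) =
      (v * q - α) * (1 - β * v) / ((1 - α * v) * (v * q - β)) * thetaQuot q α β v := by
  have h1' : 1 - α * v ≠ 0 := sub_ne_zero.2 h1.symm
  have h2' : 1 - β * v ≠ 0 := sub_ne_zero.2 h2.symm
  have h3' : v * q - β ≠ 0 := sub_ne_zero.2 h3
  have a1 := qPochInf_eq_one_sub_mul (α * v) hq
  have a2 := qPochInf_eq_one_sub_mul (β * v) hq
  have a3 : qPochInf (α / (v * q)) q = (v * q - α) / (v * q) * qPochInf (α / v) q := by
    rw [qPochInf_eq_one_sub_mul _ hq]; congr 2 <;> field_simp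
  have a4 : qPochInf (β / (v * q)) q = (v * q - β) / (v * q) * qPochInf (β / v) q := by
    rw [qPochInf_eq_one_sub_mul _ hq]; congr 2 <;> field_simp
  simp only [thetaQuot]
  rw [a1, a2, a3, a4, ← mul_assoc α, ← mul_assoc β]
  generalize 1 - α * v = X at *
  generalize 1 - β * v = Y at *
  generalize v * q - β = Z at *
  generalize qPochInf (α * v * q) q = A
  generalize qPochInf (β * v * q) q = B
  generalize qPochInf (α / v) q = C
  generalize qPochInf (β / v) q = D
  rcases eq_or_ne B 0 with rfl | hB
  · simp
  rcases eq_or_ne D 0 with rfl | hD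
  · simp
  field_simp

section Interpolation

variable {q α β ξ : ℝ}

lemma ofReal_mul_pow_ne_one_of_neg (hq0 : 0 < q) {a : ℝ} (ha : a < 0) (j : ℕ) :
    (a : ℂ) * (q : ℂ) ^ j ≠ 1 := by
  have : a * q ^ j ≠ 1 := by
    have := mul_neg_of_neg_of_pos ha (pow_pos hq0 j)
    linarith
  exact_mod_cast this

lemma ofReal_mul_pow_self_ne_one (hq0 : 0 < q) (hq1 : q < 1) (j : ℕ) :
    (q : ℂ) * (q : ℂ) ^ j ≠ 1 := by
  have : q * q ^ j ≠ 1 := by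
    rw [← pow_succ']
    exact (pow_lt_one₀ hq0.le hq1 (by simp)).ne
  exact_mod_cast this

/-- The partial sum of the `₃φ₂` series, scaled by its prefactor. -/
noncomputable def partialExpansion (q α β ξ : ℂ) (N : ℕ) (v : ℂ) : ℂ :=
  thetaQuot q α β ξ * ∑ k ∈ Finset.range N,
    phi32Term (α / β) (ξ * v) (ξ / v) (α * ξ) (q * ξ / β) q q k

/-- The partial sums of the expansion interpolate the quotient at the points `ξ q^n`. -/
lemma partialExpansion_node (hq0 : 0 < q) (hq1 : q < 1) (hβ : 0 < β) (hξ : ξ < 0)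
    (hαξ : ∀ n : ℕ, α * ξ * q ^ n ≠ 1) {n N : ℕ} (hn : n < N) :
    partialExpansion q α β ξ N (ξ * q ^ n) = thetaQuot q α β (ξ * q ^ n) := by
  have hq := norm_ofReal_lt_one hq0 hq1
  have hqc : (q : ℂ) ≠ 0 := by exact_mod_cast hq0.ne'
  have hβc : (β : ℂ) ≠ 0 := by exact_mod_cast hβ.ne'
  have hξc : (ξ : ℂ) ≠ 0 := by exact_mod_cast hξ.ne
  have hd : ∀ j : ℕ, (α : ℂ) * ξ * (q : ℂ) ^ j ≠ 1 := fun j => by exact_mod_cast hαξ j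
  have he : ∀ j : ℕ, (q : ℂ) * ξ / β * (q : ℂ) ^ j ≠ 1 := fun j => by
    have := ofReal_mul_pow_ne_one_of_neg hq0
      (div_neg_of_neg_of_pos (mul_neg_of_pos_of_neg hq0 hξ) hβ) j
    exact_mod_cast this
  have hqq := ofReal_mul_pow_self_ne_one hq0 hq1
  induction n with
  | zero =>
    obtain ⟨M, rfl⟩ : ∃ M, N = M + 1 := ⟨N - 1, by omega⟩
    rw [partialExpansion, Finset.sum_range_succ', Finset.sum_eq_zero]
    · simp [phi32Term, qPoch_zero]
    -- At the first node the factor (ξ/v; q)_k is (1; q)_k, which vanishes for k ≥ 1.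
    · intro k _
      rw [phi32Term, qPoch_eq_zero (a := ξ / (ξ * q ^ 0)) (j := 0) (by omega) (by simp [hξc])]
      simp
  | succ n ih =>
    have hy : (q : ℂ) ^ n ≠ 0 := pow_ne_zero _ hqc
    have hneg : ξ * q ^ n < 0 := mul_neg_of_neg_of_pos hξ (pow_pos hq0 n)
    have hb1 : (β : ℂ) * (ξ * q ^ n) ≠ 1 := by
      have : β * (ξ * q ^ n) ≠ 1 := by linarith [mul_neg_of_pos_of_neg hβ hneg]
      exact_mod_cast this
    have hb2 : (ξ : ℂ) * q ^ n * q ≠ β := by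
      have : ξ * q ^ n * q ≠ β := by linarith [mul_neg_of_neg_of_pos hneg hq0]
      exact_mod_cast this
    have hb3 : (q : ℂ) * ξ * q ^ n ≠ β := by
      convert hb2 using 1; ring
    -- With y = qⁿ and K = N - 1 the right side contains (q⁻ⁿ; q)_{N-1}, which is zero because n < N
    -- - 1; the identity becomes an exact recurrence.
    have hrec := sum_sub_mul_sum_eq hqq hqc hy hβc hξc hd he (hd n) hb3 (N - 1)
    rw [qPoch_eq_zero (a := ((q : ℂ) ^ n)⁻¹) (j := n) (by omega) (inv_mul_cancel₀ hy),
      Nat.sub_add_cancel (by omega), Finset.sum_sub_distrib, ← Finset.mul_sum, mul_zero, zero_div,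
      mul_zero, sub_eq_zero] at hrec
    have ih := ih (by omega)
    rw [partialExpansion] at ih ⊢
    rw [pow_succ, hrec, ← mul_assoc (ξ : ℂ) ((q : ℂ) ^ n),
      thetaQuot_mul_q hq hqc (mul_ne_zero hξc hy) (by rw [← mul_assoc]; exact hd n) hb1 hb2, ← ih]
    simp only [← mul_assoc]
    ring

end Interpolation

/-! ### Cauchy's formula for a half plane -/

open MeasureTheory Complex Bornology

lemma cayley_re (w : ℂ) : ((w + 1) / (w - 1)).re = (normSq w - 1) / normSq (w - 1) := by
  rw [div_re, ← add_div]
  congr 1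
  simp only [normSq_apply, add_re, sub_re, add_im, sub_im, one_re, one_im]
  ring

/-- The Cayley map is an involution, so the same formula carries the disc to the left half plane and
back. -/
lemma cayley_cayley {v : ℂ} (hv : v ≠ 1) : ((v + 1) / (v - 1) + 1) / ((v + 1) / (v - 1) - 1) = v := by
  have : v - 1 ≠ 0 := sub_ne_zero.2 hv
  have h2 : (v + 1) / (v - 1) - 1 = 2 / (v - 1) := by field_simp; ring
  rw [h2]
  field_simp
  ring

/-- The substitution θ = π + 2 arctan s turns the unit circle without the point 1, which corresponds
to ∞, into the imaginary axis. -/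
lemma exp_pi_add_two_arctan (s : ℝ) :
    exp ((Real.pi + 2 * Real.arctan s : ℝ) * I) = (s * I + 1) / (s * I - 1) := by
  have hs : (0 : ℝ) < 1 + s ^ 2 := by positivity
  have h1 : exp (Real.arctan s * I) = (1 + s * I) / (√(1 + s ^ 2) : ℝ) := by
    rw [exp_mul_I, ← ofReal_cos, ← ofReal_sin, Real.cos_arctan, Real.sin_arctan]
    push_cast
    ring
  have h2 : ((√(1 + s ^ 2) : ℝ) : ℂ) ^ 2 = (1 + s * I) * (1 - s * I) := by
    rw [← ofReal_pow, Real.sq_sqrt hs.le]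
    push_cast
    linear_combination ((s : ℂ) ^ 2) * I_sq
  have h3 : (1 : ℂ) + s * I ≠ 0 := fun h => by simpa using congrArg re h
  have h4 : (1 : ℂ) - s * I ≠ 0 := fun h => by simpa using congrArg re h
  have h5 : (s : ℂ) * I - 1 ≠ 0 := fun h => by simpa using congrArg re h
  have : ((Real.pi + 2 * Real.arctan s : ℝ) : ℂ) * I
      = Real.pi * I + ((2 : ℕ) : ℂ) * (Real.arctan s * I) := by
    push_cast; ring
  rw [this, exp_add, exp_pi_mul_I, exp_nat_mul, h1, div_pow, h2]
  have h6 : (s : ℂ) * I - 1 = -(1 - s * I) := by ring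
  rw [h6]
  generalize hX : (1 : ℂ) + s * I = X at *
  generalize (1 : ℂ) - s * I = Y at *
  field_simp
  rw [← hX]; ring

lemma image_pi_add_two_arctan :
    (fun s : ℝ => Real.pi + 2 * Real.arctan s) '' Set.univ = Set.Ioo 0 (2 * Real.pi) := by
  have h : (fun s : ℝ => Real.pi + 2 * Real.arctan s) '' Set.univ =
      (fun t => Real.pi + 2 * t) '' Set.range Real.arctan := by
    rw [Set.image_univ, ← Set.range_comp]; rfl
  rw [h, Real.range_arctan]
  ext x
  simp only [Set.mem_image, Set.mem_Ioo]
  constructor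
  · rintro ⟨t, ⟨h1, h2⟩, rfl⟩
    constructor <;> linarith
  · rintro ⟨h1, h2⟩
    exact ⟨(x - Real.pi) / 2, ⟨by linarith, by linarith⟩, by ring⟩

/-- The Cauchy integral formula for the left half plane. -/
theorem cauchy_leftHalfPlane {g : ℂ → ℂ} {L u : ℂ} (hc : ContinuousOn g {v | v.re ≤ 0})
    (hd : DifferentiableOn ℂ g {v | v.re < 0})
    (hL : Tendsto (fun v => v * g v) (cobounded ℂ ⊓ 𝓟 {v | v.re ≤ 0}) (𝓝 L)) (hu : u.re < 0) :
    Integrable (fun s : ℝ => g (s * I) / (s * I - u)) ∧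
      ∫ s : ℝ, g (s * I) / (s * I - u) = 2 * Real.pi * g u := by
  classical
  set c : ℂ → ℂ := fun w => (w + 1) / (w - 1) with hcdef
  -- The factor c w - 1 = 2/(w - 1) matches the decay of g: (v - 1) g v tends to L, so the value L
  -- at w = 1 makes G continuous on the closed disc.
  set G₀ : ℂ → ℂ := fun w => (c w - 1) * g (c w) with hG₀
  set G : ℂ → ℂ := Function.update G₀ 1 L with hG
  have hGne : ∀ w, w ≠ 1 → G w = G₀ w := fun w hw => Function.update_of_ne hw _ _
  have hu1 : u ≠ 1 := fun h => by rw [h] at hu; norm_num at hu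
  have hu1' : u - 1 ≠ 0 := sub_ne_zero.2 hu1
  have hcre : ∀ w, (c w).re = (normSq w - 1) / normSq (w - 1) := cayley_re
  have hball : ∀ w ∈ Metric.ball (0 : ℂ) 1, w ≠ 1 ∧ (c w).re < 0 := by
    intro w hw
    have hw1 : ‖w‖ < 1 := by simpa using hw
    have hne : w ≠ 1 := by rintro rfl; simp at hw1
    refine ⟨hne, ?_⟩
    rw [hcre, normSq_eq_norm_sq]
    exact div_neg_of_neg_of_pos (by nlinarith [norm_nonneg w]) (normSq_pos.2 (sub_ne_zero.2 hne))
  have hcball : ∀ w ∈ Metric.closedBall (0 : ℂ) 1, (c w).re ≤ 0 := by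
    intro w hw
    have hw1 : ‖w‖ ≤ 1 := by simpa using hw
    rw [hcre, normSq_eq_norm_sq]
    exact div_nonpos_of_nonpos_of_nonneg (by nlinarith [norm_nonneg w]) (normSq_nonneg _)
  have hccont : ∀ w, w ≠ 1 → DifferentiableAt ℂ c w := fun w hw => by
    have : w - 1 ≠ 0 := sub_ne_zero.2 hw
    simp only [hcdef]
    fun_prop (disch := assumption)
  have hGc : ContinuousOn G (Metric.closedBall 0 1) := by
    intro w hw
    rcases eq_or_ne w 1 with rfl | hw1
    · rw [hG, continuousWithinAt_update_same]
      have hinv : Tendsto (fun w : ℂ => (w - 1)⁻¹) (𝓝[≠] 1) (cobounded ℂ) := by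
        refine tendsto_inv₀_nhdsNE_zero.comp ?_
        refine tendsto_nhdsWithin_iff.2 ⟨?_, ?_⟩
        · exact (Continuous.tendsto' (by fun_prop) _ _ (by simp)).mono_left nhdsWithin_le_nhds
        · filter_upwards [self_mem_nhdsWithin] with w hw
          simpa [sub_eq_zero] using hw
      have hcob : Tendsto c (𝓝[≠] 1) (cobounded ℂ) := by
        have h2 : Tendsto (fun w : ℂ => 1 + 2 * (w - 1)⁻¹) (𝓝[≠] 1) (cobounded ℂ) := by
          rw [← tendsto_norm_atTop_iff_cobounded] at hinv ⊢
          refine tendsto_atTop_mono (f := fun w : ℂ => 2 * ‖(w - 1)⁻¹‖ + -1) (fun w => ?_) ?_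
          · have := norm_sub_le (1 + 2 * (w - 1)⁻¹) 1
            rw [add_sub_cancel_left, norm_mul, norm_one] at this
            norm_num at this ⊢
            linarith
          · exact tendsto_atTop_add_const_right _ _ (hinv.const_mul_atTop (by norm_num))
        refine h2.congr' ?_
        filter_upwards [self_mem_nhdsWithin] with w hw
        have : w - 1 ≠ 0 := sub_ne_zero.2 hw
        simp only [hcdef]; field_simp; ring
      have hT : Tendsto c (𝓝[Metric.closedBall 0 1 \ {1}] 1)
          (cobounded ℂ ⊓ 𝓟 {v | v.re ≤ 0}) := by
        refine tendsto_inf.2 ⟨hcob.mono_left (nhdsWithin_mono _ fun w hw => hw.2), ?_⟩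
        refine tendsto_principal.2 ?_
        filter_upwards [self_mem_nhdsWithin] with w hw using hcball w hw.1
      have hL' : Tendsto (fun v => (v - 1) * g v) (cobounded ℂ ⊓ 𝓟 {v | v.re ≤ 0}) (𝓝 L) := by
        have h0 : Tendsto (fun v : ℂ => v⁻¹) (cobounded ℂ ⊓ 𝓟 {v | v.re ≤ 0}) (𝓝 0) :=
          tendsto_inv₀_cobounded.mono_left inf_le_left
        have h1 := hL.sub (h0.mul hL)
        rw [zero_mul, sub_zero] at h1
        refine h1.congr' ?_
        have hne : ∀ᶠ v : ℂ in cobounded ℂ ⊓ 𝓟 {v | v.re ≤ 0}, v ≠ 0 :=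
          (eventually_ne_cobounded 0).filter_mono inf_le_left
        filter_upwards [hne] with v hv
        field_simp
      exact hL'.comp hT
    · have hev : G =ᶠ[𝓝[Metric.closedBall 0 1] w] G₀ := by
        filter_upwards [mem_nhdsWithin_of_mem_nhds (isOpen_ne.mem_nhds hw1)] with z hz
          using hGne z hz
      refine ContinuousWithinAt.congr_of_eventuallyEq ?_ hev (hGne w hw1)
      have h1 : ContinuousWithinAt c (Metric.closedBall 0 1) w :=
        (hccont w hw1).continuousAt.continuousWithinAt
      exact (h1.sub continuousWithinAt_const).mul ((hc _ (hcball w hw)).comp h1 hcball)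
  have hGd : ∀ w ∈ Metric.ball (0 : ℂ) 1 \ ∅, DifferentiableAt ℂ G w := by
    intro w hw
    obtain ⟨hw1, hwre⟩ := hball w hw.1
    have hev : G =ᶠ[𝓝 w] G₀ := by
      filter_upwards [isOpen_ne.mem_nhds hw1] with z hz using hGne z hz
    refine DifferentiableAt.congr_of_eventuallyEq ?_ hev
    have hopen : IsOpen {v : ℂ | v.re < 0} := isOpen_lt continuous_re continuous_const
    have h1 := hccont w hw1
    exact (h1.sub_const 1).mul ((hd.differentiableAt (hopen.mem_nhds hwre)).comp w h1)
  set w₀ := (u + 1) / (u - 1) with hw₀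
  have hcw₀ : c w₀ = u := cayley_cayley hu1
  have hw₀1 : w₀ ≠ 1 := by
    rw [hw₀, Ne, div_eq_one_iff_eq hu1']
    intro h
    have : (2 : ℂ) = 0 := by linear_combination h
    norm_num at this
  have hw₀b : w₀ ∈ Metric.ball (0 : ℂ) 1 := by
    have := hcre w₀
    rw [hcw₀] at this
    have hpos : 0 < normSq (w₀ - 1) := normSq_pos.2 (sub_ne_zero.2 hw₀1)
    have h2 : normSq w₀ - 1 < 0 := by
      rw [eq_div_iff hpos.ne'] at this
      rw [← this]
      exact mul_neg_of_neg_of_pos hu hpos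
    rw [normSq_eq_norm_sq] at h2
    have : ‖w₀‖ < 1 := by
      by_contra! h
      nlinarith
    simpa using this
  have hcauchy := circleIntegral_sub_inv_smul_of_differentiable_on_off_countable
    Set.countable_empty hw₀b hGc hGd
  set F : ℝ → ℂ := fun θ => deriv (circleMap 0 1) θ •
    ((circleMap 0 1 θ - w₀)⁻¹ • G (circleMap 0 1 θ)) with hF
  have hint : IntegrableOn F (Set.Ioo 0 (2 * Real.pi)) := by
    have hcirc : CircleIntegrable (fun w => (w - w₀)⁻¹ • G w) 0 1 := by
      refine ContinuousOn.circleIntegrable zero_le_one ?_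
      refine ContinuousOn.smul (ContinuousOn.inv₀ (f := fun w => w - w₀) (by fun_prop) ?_)
        (hGc.mono Metric.sphere_subset_closedBall)
      intro w hw h
      rw [sub_eq_zero.1 h] at hw
      simp only [Metric.mem_sphere, Metric.mem_ball] at hw hw₀b
      linarith
    have := hcirc.out
    rw [intervalIntegrable_iff_integrableOn_Ioo_of_le (by positivity)] at this
    exact this
  have hval : ∫ θ in Set.Ioo 0 (2 * Real.pi), F θ = 2 * Real.pi * I * ((u - 1) * g u) := by
    rw [circleIntegral, intervalIntegral.integral_of_le (by positivity),
      integral_Ioc_eq_integral_Ioo] at hcauchy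
    rw [show ∫ θ in Set.Ioo 0 (2 * Real.pi), F θ = _ from hcauchy, hGne _ hw₀1, hG₀]
    simp only [hcw₀, smul_eq_mul]
  have hderiv : ∀ s ∈ (Set.univ : Set ℝ), HasDerivWithinAt
      (fun s : ℝ => Real.pi + 2 * Real.arctan s) (2 * (1 / (1 + s ^ 2))) Set.univ s := fun s _ =>
    (((Real.hasDerivAt_arctan s).const_mul 2).const_add Real.pi).hasDerivWithinAt
  have hinj : Set.InjOn (fun s : ℝ => Real.pi + 2 * Real.arctan s) Set.univ := by
    intro s _ t _ h
    exact Real.arctan_injective (by simpa using h)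
  -- The Jacobian, the Cauchy kernel at w₀ and the factor c w - 1 combine to the half-plane kernel
  -- times the constant I(u - 1).
  have hpull : ∀ s : ℝ, |2 * (1 / (1 + s ^ 2))| • F (Real.pi + 2 * Real.arctan s) =
      I * (u - 1) * (g (s * I) / (s * I - u)) := by
    intro s
    have hs : (0 : ℝ) < 1 + s ^ 2 := by positivity
    have h5 : (s : ℂ) * I - 1 ≠ 0 := fun h => by simpa using congrArg re h
    have h5' : (s : ℂ) * I + 1 ≠ 0 := fun h => by simpa using congrArg re h
    have hv1 : (s : ℂ) * I ≠ 1 := sub_ne_zero.1 h5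
    have h6 : (s : ℂ) * I - u ≠ 0 := fun h => by
      have := congrArg re h
      simp at this
      linarith
    have hcm : circleMap 0 1 (Real.pi + 2 * Real.arctan s) = (s * I + 1) / (s * I - 1) := by
      rw [circleMap, ← exp_pi_add_two_arctan]; simp
    have hne : (s * I + 1) / (s * I - 1) ≠ 1 := by
      rw [Ne, div_eq_one_iff_eq h5]
      intro h
      have : (2 : ℂ) = 0 := by linear_combination h
      norm_num at this
    have hsub : ((s * I + 1) / (s * I - 1) - w₀)⁻¹ =
        -((s * I - 1) * (u - 1)) / (2 * (s * I - u)) := by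
      have : (s * I + 1) / (s * I - 1) - w₀ = 2 * (s * I - u) / (-((s * I - 1) * (u - 1))) := by
        rw [hw₀]
        generalize (s : ℂ) * I = v at *
        rw [div_sub_div _ _ h5 hu1', div_neg, ← neg_div]
        congr 1
        ring
      rw [this, inv_div]
    have hsq : ((1 : ℂ) + s ^ 2) = -((s * I - 1) * (s * I + 1)) := by
      linear_combination ((s : ℂ) ^ 2) * I_sq
    have hcv : c ((s * I + 1) / (s * I - 1)) = s * I := cayley_cayley hv1
    rw [abs_of_pos (by positivity)]
    simp only [hF, deriv_circleMap, hcm]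
    rw [hGne _ hne, hsub]
    simp only [hG₀, hcv, real_smul, smul_eq_mul]
    push_cast
    rw [hsq]
    generalize (s : ℂ) * I = v at *
    generalize g v = γ
    field_simp
  have hIu : I * (u - 1) ≠ 0 := mul_ne_zero I_ne_zero hu1'
  constructor
  · rw [← image_pi_add_two_arctan,
      integrableOn_image_iff_integrableOn_abs_deriv_smul MeasurableSet.univ hderiv hinj,
      integrableOn_univ] at hint
    simp only [hpull] at hint
    exact (integrable_const_mul_iff hIu.isUnit _).1 hint
  · rw [← image_pi_add_two_arctan,
      integral_image_eq_integral_abs_deriv_smul MeasurableSet.univ hderiv hinj,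
      setIntegral_univ] at hval
    simp only [hpull] at hval
    rw [integral_const_mul] at hval
    apply mul_left_cancel₀ hIu
    rw [hval]
    ring

/-! ### The symmetric kernel and contour integrals with it -/

/-- The kernel `(1 - v²) u / ((u - v) (u v - 1) v)`. -/
noncomputable def symmKernel (u v : ℂ) : ℂ := ((1 - v ^ 2) * u) / ((u - v) * (u * v - 1) * v)

/-- These partial fractions reduce the symmetric formula to Cauchy's formula at u and at 1/u, plus a
term at the boundary point 0. -/
lemma symmKernel_eq {u v : ℂ} (hu : u ≠ 0) (hv : v ≠ 0) (h1 : v - u ≠ 0) (h2 : v - u⁻¹ ≠ 0) :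
    symmKernel u v = 1 / (v - u) + 1 / (v - u⁻¹) - 1 / v := by
  have h3 : u - v ≠ 0 := by rw [← neg_ne_zero, neg_sub]; exact h1
  have h4 : u * v - 1 ≠ 0 := by
    have : u * v - 1 = u * (v - u⁻¹) := by field_simp
    rw [this]; exact mul_ne_zero hu h2
  have h5 : v - u⁻¹ = (u * v - 1) / u := by field_simp
  have h6 : v - u = -(u - v) := by ring
  rw [symmKernel, h5, h6]
  generalize hX : u - v = X at *
  generalize hY : u * v - 1 = Y at *
  field_simp
  rw [← hX, ← hY]
  ring

/-- Transfers the behaviour of integrands at infinity to the origin. -/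
lemma symmKernel_inv (u : ℂ) {v : ℂ} (hv : v ≠ 0) :
    symmKernel u v⁻¹ = -(v ^ 2 * symmKernel u v) := by
  have h1 : u - v⁻¹ = (u * v - 1) / v := by field_simp
  have h2 : u * v⁻¹ - 1 = (u - v) / v := by field_simp
  rw [symmKernel, symmKernel, h1, h2]
  rcases eq_or_ne (u - v) 0 with h | h3
  · simp [h]
  rcases eq_or_ne (u * v - 1) 0 with h | h4
  · simp [h]
  generalize u - v = X at *
  generalize u * v - 1 = Y at *
  field_simp
  ring

lemma tendsto_mul_symmKernel {u : ℂ} (hu : u ≠ 0) :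
    Tendsto (fun v => v * symmKernel u v) (cobounded ℂ) (𝓝 1) := by
  have hcont : ContinuousAt (fun z : ℂ => u * (z ^ 2 - 1) / ((u * z - 1) * (u - z))) 0 := by
    refine ContinuousAt.div (by fun_prop) (by fun_prop) ?_
    simpa using hu
  have h0 := hcont.tendsto.comp (tendsto_inv₀_cobounded (α := ℂ))
  have h1 : u * ((0 : ℂ) ^ 2 - 1) / ((u * 0 - 1) * (u - 0)) = 1 := by
    field_simp; ring
  rw [h1] at h0
  refine h0.congr' ?_
  filter_upwards [eventually_ne_cobounded (0 : ℂ)] with v hv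
  simp only [Function.comp, symmKernel]
  have e1 : u * v⁻¹ - 1 = (u - v) / v := by field_simp
  have e2 : u - v⁻¹ = (u * v - 1) / v := by field_simp
  have e3 : v⁻¹ ^ 2 - 1 = (1 - v ^ 2) / v ^ 2 := by field_simp
  rw [e1, e2, e3]
  rcases eq_or_ne (u - v) 0 with h | h3
  · simp [h]
  rcases eq_or_ne (u * v - 1) 0 with h | h4
  · simp [h]
  generalize u - v = X at *
  generalize u * v - 1 = Y at *
  field_simp

lemma inv_re_nonpos {v : ℂ} (hv : v.re ≤ 0) : v⁻¹.re ≤ 0 := by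
  rw [inv_re]; exact div_nonpos_of_nonpos_of_nonneg hv (normSq_nonneg _)

lemma inv_re_neg {v : ℂ} (hv : v.re < 0) : v⁻¹.re < 0 := by
  rw [inv_re]
  exact div_neg_of_neg_of_pos hv (normSq_pos.2 fun h => by simp [h] at hv)

lemma ae_ne_zero : ∀ᵐ s : ℝ, s ≠ 0 := by
  simp [ae_iff, measure_singleton]

lemma ne_zero_of_re_neg {u : ℂ} (hu : u.re < 0) : u ≠ 0 := by
  rintro rfl; simp at hu

lemma ofReal_mul_I_sub_ne_zero {u : ℂ} (hu : u.re < 0) (s : ℝ) : (s : ℂ) * I - u ≠ 0 := fun h => by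
  have := congrArg re h
  simp at this
  linarith

/-- The Cauchy formula for the left half plane with the kernel invariant under `v ↦ 1/v`. -/
theorem cauchy_symmKernel {g : ℂ → ℂ} {L L' u : ℂ}
    (hc : ContinuousOn g {v | v.re ≤ 0 ∧ v ≠ 0}) (hd : DifferentiableOn ℂ g {v | v.re < 0})
    (hL : Tendsto (fun v => v * g v) (cobounded ℂ ⊓ 𝓟 {v | v.re ≤ 0}) (𝓝 L))
    (hL' : Tendsto (fun v => v⁻¹ * g v) (𝓝[{v | v.re ≤ 0} \ {0}] 0) (𝓝 L'))
    (hu : u.re < 0) :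
    Integrable (fun s : ℝ => g (s * I) * symmKernel u (s * I)) ∧
      ∫ s : ℝ, g (s * I) * symmKernel u (s * I) = 2 * Real.pi * (g u + g u⁻¹) := by
  classical
  have hu0 := ne_zero_of_re_neg hu
  have hcob : ∀ᶠ v : ℂ in cobounded ℂ ⊓ 𝓟 {v | v.re ≤ 0}, v ≠ 0 :=
    (eventually_ne_cobounded 0).filter_mono inf_le_left
  -- extension of a function across the origin
  have ext : ∀ (k : ℂ → ℂ) (l : ℂ), ContinuousOn k {v | v.re ≤ 0 ∧ v ≠ 0} →
      DifferentiableOn ℂ k {v | v.re < 0} →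
      Tendsto k (𝓝[{v | v.re ≤ 0} \ {0}] 0) (𝓝 l) →
      Tendsto (fun v => v * k v) (cobounded ℂ ⊓ 𝓟 {v | v.re ≤ 0}) (𝓝 L) →
      ∀ w : ℂ, w.re < 0 → Integrable (fun s : ℝ => k (s * I) / (s * I - w)) ∧
        ∫ s : ℝ, k (s * I) / (s * I - w) = 2 * Real.pi * k w := by
    intro k l kc kd kl kL w hw
    have hw0 := ne_zero_of_re_neg hw
    have hev : ∀ v : ℂ, v ≠ 0 → Function.update k 0 l =ᶠ[𝓝 v] k := fun v hv => by
      filter_upwards [isOpen_ne.mem_nhds hv] with z hz using Function.update_of_ne hz _ _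
    have := cauchy_leftHalfPlane (g := Function.update k 0 l) (L := L) (u := w) ?_ ?_ ?_ hw
    · rw [Function.update_of_ne hw0] at this
      have hae : (fun s : ℝ => Function.update k 0 l (s * I) / (s * I - w)) =ᵐ[volume]
          fun s : ℝ => k (s * I) / (s * I - w) := by
        filter_upwards [ae_ne_zero] with s hs
        rw [Function.update_of_ne (by simpa using hs)]
      exact ⟨this.1.congr hae, (integral_congr_ae hae) ▸ this.2⟩
    · intro v hv
      rcases eq_or_ne v 0 with rfl | hv0
      · rw [continuousWithinAt_update_same]
        exact kl
      · have h1 : ContinuousWithinAt k {v : ℂ | v.re ≤ 0} v := by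
          refine (kc v ⟨hv, hv0⟩).mono_of_mem_nhdsWithin ?_
          filter_upwards [self_mem_nhdsWithin,
            mem_nhdsWithin_of_mem_nhds (isOpen_ne.mem_nhds hv0)] with z hz hz' using ⟨hz, hz'⟩
        exact h1.congr_of_eventuallyEq ((hev v hv0).filter_mono nhdsWithin_le_nhds)
          (Function.update_of_ne hv0 _ _)
    · exact kd.congr fun v hv => Function.update_of_ne (ne_zero_of_re_neg hv) _ _
    · refine kL.congr' ?_
      filter_upwards [hcob] with v hv
      rw [Function.update_of_ne hv]
  have hid : Tendsto (fun v : ℂ => v) (𝓝[{v | v.re ≤ 0} \ {0}] 0) (𝓝 0) :=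
    tendsto_id.mono_left nhdsWithin_le_nhds
  have hg0 : Tendsto g (𝓝[{v | v.re ≤ 0} \ {0}] 0) (𝓝 0) := by
    have := hid.mul hL'
    rw [zero_mul] at this
    refine this.congr' ?_
    filter_upwards [self_mem_nhdsWithin] with v hv
    have : v ≠ 0 := hv.2
    field_simp
  have c1 := ext g 0 hc hd hg0 hL u hu
  have c2 := ext g 0 hc hd hg0 hL u⁻¹ (inv_re_neg hu)
  -- The 1/v term integrates to zero: g/v is the Cauchy integrand at u of (v - u)g(v)/v, which
  -- vanishes at u.
  have c3 := ext (fun v => (v - u) * (v⁻¹ * g v)) (-u * L') ?_ ?_ ?_ ?_ u hu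
  · have c3' : (fun s : ℝ => (fun v => (v - u) * (v⁻¹ * g v)) (s * I) / (s * I - u)) =
        fun s : ℝ => g (s * I) / (s * I) := by
      funext s
      have := ofReal_mul_I_sub_ne_zero hu s
      simp only
      rw [mul_div_right_comm, div_self this, one_mul, mul_comm, ← div_eq_mul_inv]
    rw [c3'] at c3
    have hae : (fun s : ℝ => g (s * I) * symmKernel u (s * I)) =ᵐ[volume] fun s : ℝ =>
        g (s * I) / (s * I - u) + g (s * I) / (s * I - u⁻¹) - g (s * I) / (s * I) := by
      filter_upwards [ae_ne_zero] with s hs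
      rw [symmKernel_eq hu0 (by simpa using hs) (ofReal_mul_I_sub_ne_zero hu s)
        (ofReal_mul_I_sub_ne_zero (inv_re_neg hu) s)]
      ring
    have c12 : Integrable fun s : ℝ => g (s * I) / (s * I - u) + g (s * I) / (s * I - u⁻¹) :=
      c1.1.add c2.1
    refine ⟨(c12.sub c3.1).congr hae.symm, ?_⟩
    rw [integral_congr_ae hae, integral_sub c12 c3.1, integral_add c1.1 c2.1,
      c1.2, c2.2, c3.2]
    ring
  · refine ContinuousOn.mul (by fun_prop) (ContinuousOn.mul ?_ hc)
    exact continuousOn_inv₀.mono fun v hv => hv.2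
  · refine DifferentiableOn.mul (by fun_prop) (DifferentiableOn.mul ?_ hd)
    exact differentiableOn_inv.mono fun v hv => ne_zero_of_re_neg hv
  · have := (hid.sub_const u).mul hL'
    rwa [zero_sub] at this
  · have h0 : Tendsto (fun v : ℂ => v⁻¹) (cobounded ℂ ⊓ 𝓟 {v | v.re ≤ 0}) (𝓝 0) :=
      tendsto_inv₀_cobounded.mono_left inf_le_left
    have h1 := hL.sub ((h0.const_mul u).mul hL)
    rw [mul_zero, zero_mul, sub_zero] at h1
    refine h1.congr' ?_
    filter_upwards [hcob] with v hv
    field_simp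

/-- The integral along the imaginary axis of a function holomorphic in the right half plane and
decaying quadratically vanishes. -/
theorem integral_eq_zero_rightHalfPlane {k : ℂ → ℂ} {L : ℂ} (hc : ContinuousOn k {v | 0 ≤ v.re})
    (hd : DifferentiableOn ℂ k {v | 0 < v.re})
    (hL : Tendsto (fun v => v ^ 2 * k v) (cobounded ℂ ⊓ 𝓟 {v | 0 ≤ v.re}) (𝓝 L)) :
    Integrable (fun s : ℝ => k (s * I)) ∧ ∫ s : ℝ, k (s * I) = 0 := by
  have hneg : Tendsto (fun v : ℂ => -v) (cobounded ℂ ⊓ 𝓟 {v | v.re ≤ 0})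
      (cobounded ℂ ⊓ 𝓟 {v | 0 ≤ v.re}) := by
    refine tendsto_inf.2 ⟨?_, ?_⟩
    · refine Tendsto.mono_left ?_ inf_le_left
      rw [← tendsto_norm_atTop_iff_cobounded]
      simpa using tendsto_norm_cobounded_atTop
    · refine tendsto_principal.2 ?_
      filter_upwards [mem_inf_of_right (mem_principal_self _)] with v hv
      simpa using hv
  -- After the reflection v ↦ -v, the factor v + 1 cancels the Cauchy kernel at -1 and makes the
  -- value there zero.
  have := cauchy_leftHalfPlane (g := fun v => (v + 1) * k (-v)) (L := L) (u := -1) ?_ ?_ ?_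
    (by simp)
  · have e : (fun s : ℝ => (fun v => (v + 1) * k (-v)) (s * I) / (s * I - -1)) =
        fun s : ℝ => k ((-s : ℝ) * I) := by
      funext s
      have h : (s : ℂ) * I - -1 ≠ 0 := ofReal_mul_I_sub_ne_zero (by simp) s
      rw [sub_neg_eq_add] at h ⊢
      simp only
      rw [mul_div_right_comm, div_self h, one_mul]
      push_cast
      ring_nf
    rw [e, integral_neg_eq_self (fun s : ℝ => k (s * I))] at this
    refine ⟨by simpa using this.1.comp_neg, ?_⟩
    rw [this.2]; simp
  · refine ContinuousOn.mul (by fun_prop) (hc.comp (by fun_prop) fun v hv => ?_)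
    simpa using hv
  · refine DifferentiableOn.mul (by fun_prop) (hd.comp (by fun_prop) fun v hv => ?_)
    simpa using hv
  · have h0 : Tendsto (fun v : ℂ => v⁻¹) (cobounded ℂ ⊓ 𝓟 {v | v.re ≤ 0}) (𝓝 0) :=
      tendsto_inv₀_cobounded.mono_left inf_le_left
    have h1 := (h0.const_add 1).mul (hL.comp hneg)
    rw [add_zero, one_mul] at h1
    refine h1.congr' ?_
    filter_upwards [(eventually_ne_cobounded (0 : ℂ)).filter_mono inf_le_left] with v hv
    simp only [Function.comp]
    field_simp

/-! ### Node products: behaviour at infinity and division by them -/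

lemma tendsto_pow_div_nodePoly {q a : ℂ} (hq : q ≠ 0) (ha : a ≠ 0) (M : ℕ) :
    Tendsto (fun v => v ^ M / nodePoly q a M v) (cobounded ℂ)
      (𝓝 (∏ j ∈ Finset.range M, (-(a * q ^ j)))⁻¹) := by
  have hz : Tendsto (fun v : ℂ => v⁻¹) (cobounded ℂ) (𝓝 0) := tendsto_inv₀_cobounded
  have h1 : Tendsto (fun v : ℂ => (∏ j ∈ Finset.range M, (v⁻¹ - a * q ^ j)) * qPoch (a * v⁻¹) q M)
      (cobounded ℂ) (𝓝 ((∏ j ∈ Finset.range M, (0 - a * q ^ j)) * qPoch (a * 0) q M)) := by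
    refine Tendsto.mul (tendsto_finsetProd _ fun j _ => hz.sub_const _) ?_
    exact ((continuous_qPoch q M).tendsto _).comp (hz.const_mul a)
  have h2 : qPoch (a * 0) q M = 1 := by simp [qPoch]
  rw [h2, mul_one] at h1
  simp only [zero_sub] at h1
  have hne : ∏ j ∈ Finset.range M, (-(a * q ^ j)) ≠ 0 :=
    Finset.prod_ne_zero_iff.2 fun j _ => neg_ne_zero.2 (mul_ne_zero ha (pow_ne_zero _ hq))
  refine (h1.inv₀ hne).congr' ?_
  filter_upwards [eventually_ne_cobounded (0 : ℂ)] with v hv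
  have h3 : qPoch (a * v) q M = v ^ M * ∏ j ∈ Finset.range M, (v⁻¹ - a * q ^ j) := by
    rw [qPoch, ← Finset.card_range M, ← Finset.prod_const, Finset.card_range,
      ← Finset.prod_mul_distrib]
    refine Finset.prod_congr rfl fun j _ => ?_
    field_simp
  have hvM : v ^ M ≠ 0 := pow_ne_zero _ hv
  rw [nodePoly, h3, div_eq_mul_inv a v, mul_assoc, ← div_div, div_self hvM, one_div]

lemma tendsto_mul_inv_nodePoly {q a : ℂ} (hq : q ≠ 0) (ha : a ≠ 0) {M : ℕ} (hM : 1 ≤ M) :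
    ∃ L, Tendsto (fun v => v * (nodePoly q a M v)⁻¹) (cobounded ℂ) (𝓝 L) := by
  obtain ⟨n, rfl⟩ : ∃ n, M = n + 1 := ⟨M - 1, by omega⟩
  refine ⟨_, (((tendsto_inv₀_cobounded (α := ℂ)).pow n).mul
    (tendsto_pow_div_nodePoly hq ha (n + 1))).congr' ?_⟩
  filter_upwards [eventually_ne_cobounded (0 : ℂ)] with v hv
  rw [pow_succ, div_eq_mul_inv, ← mul_assoc, ← mul_assoc, ← mul_pow, inv_mul_cancel₀ hv, one_pow,
    one_mul]

/-- Zeros are divided out one at a time by `dslope`; since the points are distinct, the quotient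
still vanishes at the others. -/
lemma exists_eq_prod_sub_mul {ι : Type*} {U : Set ℂ} (hU : IsOpen U) (s : Finset ι) (p : ι → ℂ)
    (hp : Set.InjOn p s) (hpU : ∀ i ∈ s, p i ∈ U) {h : ℂ → ℂ} (hd : DifferentiableOn ℂ h U)
    (h0 : ∀ i ∈ s, h (p i) = 0) :
    ∃ g : ℂ → ℂ, DifferentiableOn ℂ g U ∧ ∀ v, h v = (∏ i ∈ s, (v - p i)) * g v := by
  classical
  induction s using Finset.induction_on generalizing h with
  | empty => exact ⟨h, hd, by simp⟩
  | insert i s hi ih =>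
    have hiU : U ∈ 𝓝 (p i) := hU.mem_nhds (hpU i (by simp))
    have key : ∀ v, h v = (v - p i) * dslope h (p i) v := fun v => by
      have := sub_smul_dslope h (p i) v
      rw [h0 i (by simp), sub_zero, smul_eq_mul] at this
      exact this.symm
    obtain ⟨g, hg, hgv⟩ := ih (hp.mono (by simp)) (fun j hj => hpU j (by simp [hj]))
      ((Complex.differentiableOn_dslope hiU).2 hd) (fun j hj => by
        have h1 := key (p j)
        rw [h0 j (by simp [hj]), eq_comm, mul_eq_zero, sub_eq_zero] at h1
        refine h1.resolve_left fun h2 => hi ?_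
        rwa [← hp (by simp [hj]) (by simp) h2])
    exact ⟨g, hg, fun v => by rw [Finset.prod_insert hi, key v, hgv v, mul_assoc]⟩

lemma nodePoly_eq_prod {q a v : ℂ} (hq : q ≠ 0) (ha : a ≠ 0) (hv : v ≠ 0) (N : ℕ) :
    nodePoly q a N v = (∏ j ∈ Finset.range N, (v - a * q ^ j)) *
      (∏ j ∈ Finset.range N, (v - (a * q ^ j)⁻¹)) *
      ((∏ j ∈ Finset.range N, (-(a * q ^ j))) / v ^ N) := by
  have h : v ^ N = ∏ j ∈ Finset.range N, v := by simp
  rw [nodePoly, qPoch, qPoch, h, ← Finset.prod_div_distrib, ← Finset.prod_mul_distrib,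
    ← Finset.prod_mul_distrib, ← Finset.prod_mul_distrib]
  refine Finset.prod_congr rfl fun j _ => ?_
  have hj : q ^ j ≠ 0 := pow_ne_zero _ hq
  field_simp
  ring

lemma nodePoly_add (q a : ℂ) (k n : ℕ) (v : ℂ) :
    nodePoly q a (k + n) v = nodePoly q a k v * nodePoly q (a * q ^ k) n v := by
  simp only [nodePoly, qPoch_add, mul_right_comm a, div_mul_eq_mul_div]
  ring

lemma differentiableAt_nodePoly (q a : ℂ) (n : ℕ) {v : ℂ} (hv : v ≠ 0) :
    DifferentiableAt ℂ (nodePoly q a n) v := by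
  unfold nodePoly qPoch
  fun_prop (disch := exact hv)

/-- The coefficient of `(ξ v, ξ/v; q)_k` in the `₃φ₂` series. -/
noncomputable def phi32Coeff (a d e q : ℂ) (k : ℕ) : ℂ :=
  qPoch a q k / (qPoch q q k * qPoch d q k * qPoch e q k) * q ^ k

lemma phi32Term_eq_coeff_mul (a d e q ξ v : ℂ) (k : ℕ) :
    phi32Term a (ξ * v) (ξ / v) d e q q k = phi32Coeff a d e q k * nodePoly q ξ k v := by
  simp only [phi32Term, phi32Coeff, nodePoly]
  ring

lemma partialExpansion_eq (q α β ξ : ℂ) (N : ℕ) (v : ℂ) :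
    partialExpansion q α β ξ N v = ∑ k ∈ Finset.range N,
      thetaQuot q α β ξ * phi32Coeff (α / β) (α * ξ) (q * ξ / β) q k * nodePoly q ξ k v := by
  simp only [partialExpansion, phi32Term_eq_coeff_mul, Finset.mul_sum, mul_assoc]

lemma partialExpansion_inv (q α β ξ : ℂ) (N : ℕ) (v : ℂ) :
    partialExpansion q α β ξ N v⁻¹ = partialExpansion q α β ξ N v := by
  simp only [partialExpansion_eq, nodePoly_inv]

lemma differentiableAt_partialExpansion (q α β ξ : ℂ) (N : ℕ) {v : ℂ} (hv : v ≠ 0) :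
    DifferentiableAt ℂ (partialExpansion q α β ξ N) v := by
  simp only [funext (partialExpansion_eq q α β ξ N)]
  exact DifferentiableAt.fun_sum fun k _ => (differentiableAt_nodePoly q ξ k hv).const_mul _

/-! ### Analyticity and estimates for real parameters -/

section RealParameters

variable {q α β ξ : ℝ}

/-- The condition -v ∈ `slitPlane` says that v avoids [0, ∞), which contains the origin and all
zeros of (βv, β/v; q)_∞. -/
lemma ne_ofReal_of_neg_mem_slitPlane {v : ℂ} (hv : -v ∈ slitPlane) {r : ℝ} (hr : 0 ≤ r) :
    v ≠ r := by
  rintro rfl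
  simp only [mem_slitPlane_iff, neg_re, ofReal_re, neg_im, ofReal_im, neg_zero, ne_eq,
    not_true_eq_false, or_false] at hv
  linarith

lemma neg_mem_slitPlane_of_re_nonpos {v : ℂ} (hv : v.re ≤ 0) (h0 : v ≠ 0) : -v ∈ slitPlane := by
  rw [mem_slitPlane_iff]
  by_contra! h
  simp only [neg_re, neg_im, neg_eq_zero] at h
  exact h0 (Complex.ext (le_antisymm hv (neg_nonpos.1 h.1)) h.2)

lemma qPochInf_mul_ne_zero (hq0 : 0 < q) (hq1 : q < 1) (hβ : 0 < β) {v : ℂ}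
    (hv : -v ∈ slitPlane) : qPochInf (β * v) q ≠ 0 := by
  refine qPochInf_ne_zero (norm_ofReal_lt_one hq0 hq1) fun j h => ?_
  refine ne_ofReal_of_neg_mem_slitPlane hv (r := (β * q ^ j)⁻¹) (by positivity) ?_
  rw [ofReal_inv]
  refine eq_inv_of_mul_eq_one_left ?_
  push_cast
  linear_combination h

lemma qPochInf_div_ne_zero (hq0 : 0 < q) (hq1 : q < 1) (hβ : 0 < β) {v : ℂ}
    (hv : -v ∈ slitPlane) : qPochInf (β / v) q ≠ 0 := by
  refine qPochInf_ne_zero (norm_ofReal_lt_one hq0 hq1) fun j h => ?_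
  refine ne_ofReal_of_neg_mem_slitPlane hv (r := β * q ^ j) (by positivity) ?_
  have hv0 : v ≠ 0 := by
    have := ne_ofReal_of_neg_mem_slitPlane hv le_rfl
    simpa using this
  push_cast
  field_simp at h
  exact h.symm

lemma differentiableAt_thetaQuot (hq0 : 0 < q) (hq1 : q < 1) (α : ℝ) (hβ : 0 < β) {v : ℂ}
    (hv : -v ∈ slitPlane) : DifferentiableAt ℂ (thetaQuot q α β) v := by
  have hq := norm_ofReal_lt_one hq0 hq1
  have hv0 : v ≠ 0 := by
    have := ne_ofReal_of_neg_mem_slitPlane hv le_rfl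
    simpa using this
  have h1 : ∀ a : ℂ, DifferentiableAt ℂ (fun v => qPochInf (a * v) q) v := fun a =>
    (differentiable_qPochInf hq _).comp v (by fun_prop)
  have h2 : ∀ a : ℂ, DifferentiableAt ℂ (fun v => qPochInf (a / v) q) v := fun a =>
    (differentiable_qPochInf hq _).comp v (by fun_prop (disch := exact hv0))
  exact ((h1 _).mul (h2 _)).div ((h1 _).mul (h2 _)) (mul_ne_zero
    (qPochInf_mul_ne_zero hq0 hq1 hβ hv) (qPochInf_div_ne_zero hq0 hq1 hβ hv))

lemma norm_thetaQuot_le (hq0 : 0 < q) (hq1 : q < 1) {m : ℕ} (hm : |α * q ^ m| ≤ β) {v : ℂ}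
    (hv : v.re ≤ 0) :
    ‖thetaQuot q α β v‖ ≤ ((1 + |α| * ‖v‖) * (1 + |α| * ‖v‖⁻¹)) ^ m := by
  have h1 := norm_qPochInf_div_le hq0 hq1 hm hv
  have h2 := norm_qPochInf_div_le hq0 hq1 hm (inv_re_nonpos hv)
  rw [norm_inv, ← div_eq_mul_inv (α : ℂ), ← div_eq_mul_inv (β : ℂ)] at h2
  rw [thetaQuot, mul_div_mul_comm, norm_mul, mul_pow]
  gcongr

/-- Off a compact set of the left half plane, the quotient is dominated by `(ξ v, ξ/v; q)_N`. -/
lemma tendsto_mul_thetaQuot_div_nodePoly (hq0 : 0 < q) (hq1 : q < 1) {m N : ℕ}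
    (hm : |α * q ^ m| ≤ β) (hN : m + 2 ≤ N) {a : ℂ} (ha : a ≠ 0) :
    Tendsto (fun v => v * (thetaQuot q α β v / nodePoly q a N v))
      (cobounded ℂ ⊓ 𝓟 {v | v.re ≤ 0}) (𝓝 0) := by
  have hqc : (q : ℂ) ≠ 0 := by exact_mod_cast hq0.ne'
  -- The function splits as v^{-(n+1)} · (v^N/ω_N) · (f/v^m): a null factor, a convergent one and a
  -- bounded one.
  obtain ⟨n, rfl⟩ : ∃ n, N = m + 1 + (n + 1) := ⟨N - (m + 2), by omega⟩
  have h1 : Tendsto (fun v : ℂ => v⁻¹ ^ (n + 1) *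
      (v ^ (m + 1 + (n + 1)) / nodePoly q a (m + 1 + (n + 1)) v))
      (cobounded ℂ ⊓ 𝓟 {v | v.re ≤ 0}) (𝓝 0) := by
    have := ((tendsto_inv₀_cobounded (α := ℂ)).pow (n + 1)).mul
      (tendsto_pow_div_nodePoly hqc ha (m + 1 + (n + 1)))
    rw [zero_pow (by omega), zero_mul] at this
    exact this.mono_left inf_le_left
  have h2 : IsBoundedUnder (· ≤ ·) (cobounded ℂ ⊓ 𝓟 {v | v.re ≤ 0})
      (norm ∘ fun v : ℂ => thetaQuot q α β v / v ^ m) := by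
    refine ⟨((1 + |α|) * (1 + |α|)) ^ m, ?_⟩
    rw [eventually_map]
    have hnorm : ∀ᶠ v : ℂ in cobounded ℂ ⊓ 𝓟 {v | v.re ≤ 0}, 1 ≤ ‖v‖ :=
      (tendsto_norm_cobounded_atTop.eventually_ge_atTop 1).filter_mono inf_le_left
    filter_upwards [hnorm, mem_inf_of_right (mem_principal_self _)] with v hv1 hv
    have hv0 : 0 < ‖v‖ := by linarith
    simp only [Function.comp, norm_div, norm_pow]
    rw [div_le_iff₀ (by positivity), ← mul_pow]
    refine (norm_thetaQuot_le hq0 hq1 hm hv).trans ?_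
    have hi : ‖v‖⁻¹ ≤ 1 := inv_le_one_of_one_le₀ hv1
    have e1 : 1 + |α| * ‖v‖ ≤ (1 + |α|) * ‖v‖ := by nlinarith
    have e2 : 1 + |α| * ‖v‖⁻¹ ≤ 1 + |α| := by nlinarith [abs_nonneg α]
    calc ((1 + |α| * ‖v‖) * (1 + |α| * ‖v‖⁻¹)) ^ m
        ≤ (((1 + |α|) * ‖v‖) * (1 + |α|)) ^ m := by gcongr
      _ = _ := by ring
  refine (h1.zero_mul_isBoundedUnder_le h2).congr' ?_
  filter_upwards [(eventually_ne_cobounded (0 : ℂ)).filter_mono inf_le_left] with v hv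
  generalize nodePoly q a (m + 1 + (n + 1)) v = X
  have h3 : v ^ (n + 1) ≠ 0 := pow_ne_zero _ hv
  have h4 : v ^ m ≠ 0 := pow_ne_zero _ hv
  rw [pow_add v (m + 1), inv_pow, pow_succ v m]
  generalize v ^ (n + 1) = Y at *
  generalize v ^ m = Z at *
  field_simp

lemma norm_nodePoly_le_of_abs_le (hq0 : 0 < q) {a b : ℝ} (hab : |a| ≤ b) {v : ℂ} (hv : v.re ≤ 0) (n : ℕ) :
    ‖nodePoly q a n v‖ ≤ ‖nodePoly q b n v‖ := by
  rw [nodePoly, nodePoly, norm_mul, norm_mul, div_eq_mul_inv, div_eq_mul_inv]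
  gcongr
  · exact norm_qPoch_mul_le hq0 hab hv n
  · exact norm_qPoch_mul_le hq0 hab (inv_re_nonpos hv) n

lemma nodePoly_neg (q a : ℂ) (n : ℕ) (v : ℂ) : nodePoly q a n (-v) = nodePoly q (-a) n v := by
  simp [nodePoly, div_neg, neg_div]

/-- Monotonicity of `|(a v, a/v; q)_n|` in the negative parameter `a`, for `Re v ≥ 0`. -/
lemma norm_nodePoly_le_of_le (hq0 : 0 < q) {a b : ℝ} (hab : b ≤ a) (ha : a ≤ 0) {v : ℂ}
    (hv : 0 ≤ v.re) (n : ℕ) : ‖nodePoly q a n v‖ ≤ ‖nodePoly q b n v‖ := by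
  have h := norm_nodePoly_le_of_abs_le hq0 (a := -a) (b := -b) (v := -v)
    (by rw [abs_of_nonneg (by linarith)]; linarith) (by simpa using hv) n
  simpa [nodePoly_neg] using h

/-- Comparison with the parameter 0, for which the product is 1. -/
lemma one_le_norm_nodePoly (hq0 : 0 < q) {a : ℝ} (ha : a ≤ 0) {v : ℂ}
    (hv : 0 ≤ v.re) (n : ℕ) : 1 ≤ ‖nodePoly q a n v‖ := by
  have := norm_nodePoly_le_of_le hq0 ha le_rfl hv n
  simpa [nodePoly, qPoch] using this

lemma nodePoly_ne_zero (hq0 : 0 < q) {a : ℝ} (ha : a ≤ 0) {v : ℂ}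
    (hv : 0 ≤ v.re) (n : ℕ) : nodePoly q a n v ≠ 0 :=
  norm_pos_iff.1 (one_pos.trans_le (one_le_norm_nodePoly hq0 ha hv n))

lemma differentiableAt_symmKernel {u v : ℂ} (hu : u.re < 0) (hv : 0 ≤ v.re) (hv0 : v ≠ 0) :
    DifferentiableAt ℂ (symmKernel u) v := by
  have h1 : u - v ≠ 0 := fun h => by
    have := congrArg re h
    simp at this
    linarith
  have h2 : u * v - 1 ≠ 0 := fun h => by
    have h3 : v = u⁻¹ := eq_inv_of_mul_eq_one_right (sub_eq_zero.1 h)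
    rw [h3] at hv
    exact absurd (inv_re_neg hu) (not_lt.2 hv)
  unfold symmKernel
  have : (u - v) * (u * v - 1) * v ≠ 0 := mul_ne_zero (mul_ne_zero h1 h2) hv0
  fun_prop (disch := exact this)

/-- The polynomial part of the expansion does not contribute to the integral. -/
lemma integral_symmKernel_div_nodePoly (hq0 : 0 < q) {a : ℝ} (ha : a < 0) {M : ℕ} (hM : 1 ≤ M)
    {u : ℂ} (hu : u.re < 0) :
    Integrable (fun s : ℝ => (nodePoly q a M (s * I))⁻¹ * symmKernel u (s * I)) ∧
      ∫ s : ℝ, (nodePoly q a M (s * I))⁻¹ * symmKernel u (s * I) = 0 := by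
  classical
  have hqc : (q : ℂ) ≠ 0 := by exact_mod_cast hq0.ne'
  have hac : (a : ℂ) ≠ 0 := by exact_mod_cast ha.ne
  have hu0 := ne_zero_of_re_neg hu
  set k : ℂ → ℂ := fun v => (nodePoly q a M v)⁻¹ * symmKernel u v with hk
  obtain ⟨L, hL⟩ := tendsto_mul_inv_nodePoly hqc hac hM
  have hkL : Tendsto (fun v => v ^ 2 * k v) (cobounded ℂ) (𝓝 (L * 1)) := by
    refine (hL.mul (tendsto_mul_symmKernel hu0)).congr fun v => ?_
    simp only [hk]; ring
  rw [mul_one] at hkL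
  -- The symmetry k(1/v) = -v²k(v) converts the quadratic decay at infinity into a finite limit at
  -- the origin.
  have hk0 : Tendsto k (𝓝[≠] 0) (𝓝 (-L)) := by
    refine ((hkL.comp (tendsto_inv₀_nhdsNE_zero (α := ℂ))).neg).congr' ?_
    filter_upwards [self_mem_nhdsWithin] with v hv
    have hv : v ≠ 0 := hv
    simp only [Function.comp, hk, nodePoly_inv, symmKernel_inv u hv]
    field_simp
  have hkd : ∀ v : ℂ, 0 ≤ v.re → v ≠ 0 → DifferentiableAt ℂ k v := fun v hv hv0 =>
    ((differentiableAt_nodePoly q a M hv0).inv (nodePoly_ne_zero hq0 ha.le hv M)).mul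
      (differentiableAt_symmKernel hu hv hv0)
  have hev : ∀ v : ℂ, v ≠ 0 → Function.update k 0 (-L) =ᶠ[𝓝 v] k := fun v hv => by
    filter_upwards [isOpen_ne.mem_nhds hv] with z hz using Function.update_of_ne hz _ _
  have := integral_eq_zero_rightHalfPlane (k := Function.update k 0 (-L)) (L := L) ?_ ?_ ?_
  · have hae : (fun s : ℝ => Function.update k 0 (-L) (s * I)) =ᵐ[volume]
        fun s : ℝ => k (s * I) := by
      filter_upwards [ae_ne_zero] with s hs
      rw [Function.update_of_ne (by simpa using hs)]
    exact ⟨this.1.congr hae, (integral_congr_ae hae) ▸ this.2⟩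
  · intro v hv
    rcases eq_or_ne v 0 with rfl | hv0
    · rw [continuousWithinAt_update_same]
      exact hk0.mono_left (nhdsWithin_mono _ fun v hv => hv.2)
    · exact ((hkd v hv hv0).continuousAt.congr (hev v hv0).symm).continuousWithinAt
  · intro v hv
    have hv : 0 < v.re := hv
    have hv0 : v ≠ 0 := by rintro rfl; simp at hv
    exact ((hkd v hv.le hv0).congr_of_eventuallyEq (hev v hv0)).differentiableWithinAt
  · refine (hkL.mono_left inf_le_left).congr' ?_
    filter_upwards [(eventually_ne_cobounded (0 : ℂ)).filter_mono inf_le_left] with v hv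
    rw [Function.update_of_ne hv]

/-- If the nodes `ξ q^j` and their inverses are pairwise distinct, the error of the partial
expansion is divisible by `(ξ v, ξ/v; q)_N`. -/
lemma exists_thetaQuot_sub_eq (hq0 : 0 < q) (hq1 : q < 1) (hβ : 0 < β) (hξ : ξ < 0)
    (hαξ : ∀ n : ℕ, α * ξ * q ^ n ≠ 1) (hnd : ∀ n : ℕ, ξ ^ 2 * q ^ n ≠ 1) (N : ℕ) :
    ∃ g : ℂ → ℂ, DifferentiableOn ℂ g {v | -v ∈ slitPlane} ∧ ∀ v : ℂ, v ≠ 0 →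
      thetaQuot q α β v - partialExpansion q α β ξ N v = nodePoly q ξ N v * g v := by
  have hqc : (q : ℂ) ≠ 0 := by exact_mod_cast hq0.ne'
  have hξc : (ξ : ℂ) ≠ 0 := by exact_mod_cast hξ.ne
  have hU : IsOpen {v : ℂ | -v ∈ slitPlane} := isOpen_slitPlane.preimage continuous_neg
  have hne : ∀ v : ℂ, -v ∈ slitPlane → v ≠ 0 := fun v hv => by
    simpa using ne_ofReal_of_neg_mem_slitPlane hv le_rfl
  have hd : DifferentiableOn ℂ (fun v => thetaQuot q α β v - partialExpansion q α β ξ N v)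
      {v | -v ∈ slitPlane} := fun v hv =>
    ((differentiableAt_thetaQuot hq0 hq1 α hβ hv).sub
      (differentiableAt_partialExpansion _ _ _ _ _ (hne v hv))).differentiableWithinAt
  have hneg : ∀ j : ℕ, ξ * q ^ j < 0 := fun j => mul_neg_of_neg_of_pos hξ (pow_pos hq0 j)
  have hmem : ∀ r : ℝ, r < 0 → -(r : ℂ) ∈ slitPlane := fun r hr =>
    neg_mem_slitPlane_of_re_nonpos (by simpa using hr.le) (by exact_mod_cast hr.ne)
  have hinj : Function.Injective fun j : ℕ => (ξ : ℂ) * (q : ℂ) ^ j := by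
    intro i j hij
    have h1 : (q : ℂ) ^ i = (q : ℂ) ^ j := mul_left_cancel₀ hξc hij
    exact (pow_right_strictAnti₀ hq0 hq1).injective (by exact_mod_cast h1)
  obtain ⟨g₁, hg₁, h₁⟩ := exists_eq_prod_sub_mul hU (Finset.range N)
    (fun j => (ξ : ℂ) * (q : ℂ) ^ j) hinj.injOn
    (fun j _ => by simpa using hmem _ (hneg j)) hd
    (fun j hj => by
      rw [partialExpansion_node hq0 hq1 hβ hξ hαξ (Finset.mem_range.1 hj), sub_self])
  obtain ⟨g₂, hg₂, h₂⟩ := exists_eq_prod_sub_mul hU (Finset.range N)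
    (fun j => ((ξ : ℂ) * (q : ℂ) ^ j)⁻¹) (inv_injective.comp hinj).injOn
    (fun j _ => by
      have := hmem _ (inv_lt_zero.2 (hneg j))
      push_cast at this
      exact this) hg₁
    (fun j hj => by
      have h3 := h₁ ((ξ : ℂ) * (q : ℂ) ^ j)⁻¹
      rw [thetaQuot_inv, partialExpansion_inv,
        partialExpansion_node hq0 hq1 hβ hξ hαξ (Finset.mem_range.1 hj), sub_self, eq_comm,
        mul_eq_zero] at h3
      -- The factors already removed do not vanish at an inverse node: (ξq^j)⁻¹ = ξq^i would give
      -- ξ²q^{i+j} = 1.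
      refine h3.resolve_left (Finset.prod_ne_zero_iff.2 fun i _ h4 => hnd (i + j) ?_)
      have h5 : (ξ : ℂ) * (q : ℂ) ^ j ≠ 0 := mul_ne_zero hξc (pow_ne_zero _ hqc)
      have h6 := sub_eq_zero.1 h4
      have h7 := inv_mul_cancel₀ h5
      rw [h6] at h7
      have : (ξ : ℂ) ^ 2 * (q : ℂ) ^ (i + j) = 1 := by rw [pow_add]; linear_combination h7
      exact_mod_cast this)
  have hprod : ∏ j ∈ Finset.range N, (-((ξ : ℂ) * (q : ℂ) ^ j)) ≠ 0 :=
    Finset.prod_ne_zero_iff.2 fun j _ => neg_ne_zero.2 (mul_ne_zero hξc (pow_ne_zero _ hqc))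
  refine ⟨fun v => (v ^ N / ∏ j ∈ Finset.range N, (-((ξ : ℂ) * (q : ℂ) ^ j))) * g₂ v,
    DifferentiableOn.mul (by fun_prop) hg₂, fun v hv => ?_⟩
  rw [h₁, h₂, nodePoly_eq_prod hqc hξc hv]
  have hvN : v ^ N ≠ 0 := pow_ne_zero _ hv
  field_simp

/-! ### The expansion with a finite number of terms -/

/-- The integrand of the remainder after `N` terms. -/
noncomputable def remainderKernel (q α β ξ : ℂ) (N : ℕ) (u v : ℂ) : ℂ :=
  thetaQuot q α β v / nodePoly q ξ N v * symmKernel u v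

/-- The expansion with remainder after `N` terms, for pairwise distinct nodes. -/
lemma thetaQuot_eq_of_distinct (hq0 : 0 < q) (hq1 : q < 1) (hβ : 0 < β) (hξ : ξ < 0)
    (hαξ : ∀ n : ℕ, α * ξ * q ^ n ≠ 1) (hnd : ∀ n : ℕ, ξ ^ 2 * q ^ n ≠ 1) {m N : ℕ}
    (hm : |α * q ^ m| ≤ β) (hN : m + 2 ≤ N) {u : ℂ} (hu : u.re < 0) :
    Integrable (fun s : ℝ => remainderKernel q α β ξ N u (s * I)) ∧
      thetaQuot q α β u = partialExpansion q α β ξ N u +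
        nodePoly q ξ N u * (1 / (4 * Real.pi) *
          ∫ s : ℝ, remainderKernel q α β ξ N u (s * I)) := by
  have hqc : (q : ℂ) ≠ 0 := by exact_mod_cast hq0.ne'
  have hξc : (ξ : ℂ) ≠ 0 := by exact_mod_cast hξ.ne
  have hu0 := ne_zero_of_re_neg hu
  obtain ⟨g, hg, hgeq⟩ := exists_thetaQuot_sub_eq hq0 hq1 hβ hξ hαξ hnd N
  have hgq : ∀ v : ℂ, v ≠ 0 → nodePoly q ξ N v ≠ 0 → g v =
      thetaQuot q α β v / nodePoly q ξ N v -
        partialExpansion q α β ξ N v / nodePoly q ξ N v := fun v hv h => by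
    rw [← sub_div, hgeq v hv, mul_div_cancel_left₀ _ h]
  set c : ℕ → ℂ := fun k => thetaQuot q α β ξ * phi32Coeff (α / β) (α * ξ) (q * ξ / β) q k with hc
  -- Dividing the k-th basis product by ω_N leaves the reciprocal of a node product with N - k ≥ 1
  -- factors of each kind, starting at ξq^k; each such term decays at least like 1/v.
  have hpart : ∀ v : ℂ, nodePoly q ξ N v ≠ 0 → partialExpansion q α β ξ N v / nodePoly q ξ N v =
      ∑ k ∈ Finset.range N, c k * (nodePoly q (ξ * q ^ k) (N - k) v)⁻¹ := by
    intro v hv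
    rw [partialExpansion_eq, Finset.sum_div]
    refine Finset.sum_congr rfl fun k hk => ?_
    have hkN : k + (N - k) = N := Nat.add_sub_cancel' (Finset.mem_range.1 hk).le
    have hadd := nodePoly_add q ξ k (N - k) v
    rw [hkN] at hadd
    rw [hadd] at hv ⊢
    have h1 := left_ne_zero_of_mul hv
    rw [mul_div_assoc, ← div_div, div_self h1, one_div]
  have hevne : ∀ᶠ v : ℂ in cobounded ℂ, nodePoly q ξ N v ≠ 0 := by
    have hprod : (∏ j ∈ Finset.range N, (-((ξ : ℂ) * (q : ℂ) ^ j)))⁻¹ ≠ 0 :=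
      inv_ne_zero <| Finset.prod_ne_zero_iff.2 fun j _ =>
        neg_ne_zero.2 (mul_ne_zero hξc (pow_ne_zero _ hqc))
    filter_upwards [(tendsto_pow_div_nodePoly hqc hξc N).eventually_ne hprod] with v hv h
    simp [h] at hv
  have hlim : ∃ L, Tendsto (fun v => v * g v) (cobounded ℂ ⊓ 𝓟 {v | v.re ≤ 0}) (𝓝 L) := by
    have h1 : ∀ k ∈ Finset.range N, ∃ L, Tendsto
        (fun v => v * (nodePoly q (ξ * q ^ k) (N - k) v)⁻¹) (cobounded ℂ) (𝓝 L) := fun k hk =>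
      tendsto_mul_inv_nodePoly hqc (mul_ne_zero hξc (pow_ne_zero _ hqc))
        (by have := Finset.mem_range.1 hk; omega)
    choose! l hl using h1
    have h2 := (tendsto_finsetSum _ fun k hk => (hl k hk).const_mul (c k)).mono_left
      (inf_le_left (b := 𝓟 {v : ℂ | v.re ≤ 0}))
    refine ⟨_, ((tendsto_mul_thetaQuot_div_nodePoly hq0 hq1 hm hN hξc).sub h2).congr' ?_⟩
    filter_upwards [hevne.filter_mono inf_le_left,
      (eventually_ne_cobounded (0 : ℂ)).filter_mono inf_le_left] with v hv hv0
    rw [hgq v hv0 hv, hpart v hv, mul_sub, Finset.mul_sum]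
    congr 1
    exact Finset.sum_congr rfl fun k _ => by ring
  obtain ⟨L, hL⟩ := hlim
  have hinv : Tendsto (fun v : ℂ => v⁻¹) (𝓝[{v | v.re ≤ 0} \ {0}] 0)
      (cobounded ℂ ⊓ 𝓟 {v | v.re ≤ 0}) := by
    refine tendsto_inf.2 ⟨(tendsto_inv₀_nhdsNE_zero (α := ℂ)).mono_left
      (nhdsWithin_mono _ fun v hv => hv.2), tendsto_principal.2 ?_⟩
    filter_upwards [self_mem_nhdsWithin] with v hv using inv_re_nonpos hv.1
  have hsym : ∀ v : ℂ, v ≠ 0 → nodePoly q ξ N v ≠ 0 → g v⁻¹ = g v := fun v hv0 hv => by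
    rw [hgq v hv0 hv, hgq v⁻¹ (inv_ne_zero hv0) (by rwa [nodePoly_inv]), thetaQuot_inv,
      partialExpansion_inv, nodePoly_inv]
  have hL' : Tendsto (fun v => v⁻¹ * g v) (𝓝[{v | v.re ≤ 0} \ {0}] 0) (𝓝 L) := by
    refine (hL.comp hinv).congr' ?_
    filter_upwards [self_mem_nhdsWithin,
      hinv.eventually (hevne.filter_mono inf_le_left)] with v hv hv1
    rw [nodePoly_inv] at hv1
    simp only [Function.comp, hsym v hv.2 hv1]
  have hcau := cauchy_symmKernel
    (hg.continuousOn.mono fun v hv => neg_mem_slitPlane_of_re_nonpos hv.1 hv.2)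
    (hg.mono fun v (hv : v.re < 0) =>
      neg_mem_slitPlane_of_re_nonpos hv.le (ne_zero_of_re_neg hv)) hL hL' hu
  have hterm : ∀ k ∈ Finset.range N, Integrable (fun s : ℝ =>
      c k * ((nodePoly q (ξ * q ^ k) (N - k) (s * I))⁻¹ * symmKernel u (s * I))) ∧
      ∫ s : ℝ, c k * ((nodePoly q (ξ * q ^ k) (N - k) (s * I))⁻¹ * symmKernel u (s * I)) = 0 := by
    intro k hk
    have := integral_symmKernel_div_nodePoly hq0 (a := ξ * q ^ k) (M := N - k)
      (mul_neg_of_neg_of_pos hξ (pow_pos hq0 k)) (by have := Finset.mem_range.1 hk; omega) hu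
    push_cast at this
    exact ⟨this.1.const_mul _, by rw [integral_const_mul, this.2, mul_zero]⟩
  have hae : (fun s : ℝ => remainderKernel q α β ξ N u (s * I)) =ᵐ[volume] fun s : ℝ =>
      g (s * I) * symmKernel u (s * I) + ∑ k ∈ Finset.range N,
        c k * ((nodePoly q (ξ * q ^ k) (N - k) (s * I))⁻¹ * symmKernel u (s * I)) := by
    filter_upwards [ae_ne_zero] with s hs
    have h1 : nodePoly q ξ N (s * I) ≠ 0 := nodePoly_ne_zero hq0 hξ.le (by simp) N
    rw [hgq _ (by simpa using hs) h1, hpart _ h1, remainderKernel]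
    simp only [← mul_assoc]
    rw [← Finset.sum_mul]
    ring
  have hsumint := integrable_finsetSum (Finset.range N) fun k hk => (hterm k hk).1
  refine ⟨(hcau.1.add hsumint).congr hae.symm, ?_⟩
  rw [integral_congr_ae hae, integral_add hcau.1 hsumint, hcau.2,
    integral_finsetSum _ fun k hk => (hterm k hk).1,
    Finset.sum_eq_zero fun k hk => (hterm k hk).2, add_zero]
  -- If u is a node or an inverse node the remainder is zero and the interpolation property is the
  -- claim.
  rcases eq_or_ne (nodePoly q ξ N u) 0 with h0 | h0
  · have := hgeq u hu0
    rw [h0, zero_mul] at this ⊢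
    rw [add_zero]
    exact sub_eq_zero.1 this
  · have hpi : (Real.pi : ℂ) ≠ 0 := by exact_mod_cast Real.pi_ne_zero
    rw [hsym u hu0 h0]
    have := hgeq u hu0
    have e : 1 / (4 * (Real.pi : ℂ)) * (2 * Real.pi * (g u + g u)) = g u := by
      field_simp; ring
    rw [e]
    linear_combination this

/-! ### Removal of the distinctness assumption -/

lemma measurable_thetaQuot {q : ℂ} (hq : ‖q‖ < 1) (α β : ℂ) : Measurable (thetaQuot q α β) := by
  have h1 : ∀ a : ℂ, Measurable fun v => qPochInf (a * v) q := fun a =>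
    (continuous_qPochInf hq).measurable.comp (measurable_const_mul a)
  have h2 : ∀ a : ℂ, Measurable fun v => qPochInf (a / v) q := fun a =>
    (continuous_qPochInf hq).measurable.comp (measurable_id.const_div a)
  exact ((h1 α).mul (h2 α)).div ((h1 β).mul (h2 β))

lemma measurable_nodePoly (q a : ℂ) (n : ℕ) : Measurable (nodePoly q a n) :=
  ((continuous_qPoch q n).measurable.comp (measurable_const_mul a)).mul
    ((continuous_qPoch q n).measurable.comp (measurable_id.const_div a))

lemma measurable_symmKernel (u : ℂ) : Measurable (symmKernel u) := by
  unfold symmKernel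
  fun_prop

lemma measurable_remainderKernel {q : ℂ} (hq : ‖q‖ < 1) (α β ξ : ℂ) (N : ℕ) (u : ℂ) :
    Measurable (remainderKernel q α β ξ N u) :=
  ((measurable_thetaQuot hq α β).div (measurable_nodePoly q ξ N)).mul (measurable_symmKernel u)

lemma measurable_ofReal_mul_I : Measurable fun s : ℝ => (s : ℂ) * I := by fun_prop

lemma norm_remainderKernel_le_of_le (hq0 : 0 < q) (α β : ℂ) {x y : ℝ} (hxy : x ≤ y) (hy : y ≤ 0)
    (N : ℕ) (u : ℂ) (s : ℝ) :
    ‖remainderKernel q α β x N u (s * I)‖ ≤ ‖remainderKernel q α β y N u (s * I)‖ := by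
  have h1 := one_le_norm_nodePoly hq0 hy (v := s * I) (by simp) N
  have h2 := norm_nodePoly_le_of_le hq0 hxy hy (v := s * I) (by simp) N
  simp only [remainderKernel, norm_mul, norm_div]
  gcongr

lemma norm_remainderKernel_le_of_add (hq0 : 0 < q) (α β : ℂ) (hξ : ξ ≤ 0)
    (M n : ℕ) (u : ℂ) (s : ℝ) :
    ‖remainderKernel q α β ξ (M + n) u (s * I)‖ ≤ ‖remainderKernel q α β ξ M u (s * I)‖ := by
  have h1 := one_le_norm_nodePoly hq0 hξ (v := s * I) (by simp) M
  have h2 := one_le_norm_nodePoly hq0 (a := ξ * q ^ M)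
    (mul_nonpos_of_nonpos_of_nonneg hξ (by positivity)) (v := s * I) (by simp) n
  push_cast at h2
  simp only [remainderKernel, norm_mul, norm_div, nodePoly_add]
  gcongr
  exact le_mul_of_one_le_right (norm_nonneg _) h2

/-- For each n the excluded equations have at most three solutions in all, so the bad parameters
form a countable set. -/
lemma dense_distinct_nodes (hq0 : 0 < q) (α : ℝ) :
    Dense {x : ℝ | (∀ n : ℕ, x ^ 2 * q ^ n ≠ 1) ∧ ∀ n : ℕ, α * x * q ^ n ≠ 1} := by
  have hcount : (⋃ n : ℕ, {x : ℝ | x ^ 2 * q ^ n = 1} ∪ {x : ℝ | α * x * q ^ n = 1}).Countable := by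
    refine Set.countable_iUnion fun n => Set.Countable.union ?_ ?_
    · refine Set.Countable.mono (s₂ := {(√(q ^ n))⁻¹, -(√(q ^ n))⁻¹}) (fun x hx => ?_)
        ((Set.countable_singleton _).insert _)
      have hr : 0 < √(q ^ n) := Real.sqrt_pos.2 (pow_pos hq0 n)
      have h1 : (x * √(q ^ n)) ^ 2 = 1 := by
        rw [mul_pow, Real.sq_sqrt (pow_pos hq0 n).le]; exact hx
      rcases mul_self_eq_one_iff.1 ((sq _).symm.trans h1) with h | h
      · left; exact eq_inv_of_mul_eq_one_left h
      · right
        rw [Set.mem_singleton_iff, ← neg_eq_iff_eq_neg]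
        exact eq_inv_of_mul_eq_one_left (by linarith)
    · refine Set.Subsingleton.countable fun x hx y hy => ?_
      have hx : α * x * q ^ n = 1 := hx
      have hy : α * y * q ^ n = 1 := hy
      have hne : α * q ^ n ≠ 0 := fun h => by
        rw [mul_right_comm, h, zero_mul] at hx
        exact zero_ne_one hx
      exact mul_left_cancel₀ hne (by linarith)
  refine (hcount.dense_compl ℝ).mono fun x hx => ?_
  simp only [Set.mem_compl_iff, Set.mem_iUnion, Set.mem_union, Set.mem_ofPred_eq, not_exists,
    not_or] at hx
  exact ⟨fun n => (hx n).1, fun n => (hx n).2⟩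

lemma continuousAt_partialExpansion (hq0 : 0 < q) (hq1 : q < 1) (hβ : 0 < β) (hξ : ξ < 0)
    (hαξ : ∀ n : ℕ, α * ξ * q ^ n ≠ 1) (N : ℕ) (u : ℂ) :
    ContinuousAt (fun x : ℝ => partialExpansion q α β x N u) ξ := by
  have hof : ContinuousAt (fun x : ℝ => (x : ℂ)) ξ := continuous_ofReal.continuousAt
  have hθ : ContinuousAt (fun x : ℝ => thetaQuot q α β x) ξ := by
    have := (differentiableAt_thetaQuot hq0 hq1 α hβ (v := (ξ : ℂ))
      (neg_mem_slitPlane_of_re_nonpos (by simpa using hξ.le)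
        (by exact_mod_cast hξ.ne))).continuousAt
    exact ContinuousAt.comp (f := fun x : ℝ => (x : ℂ)) this hof
  refine hθ.mul (tendsto_finsetSum _ fun k _ => ?_)
  have hp : ∀ f : ℝ → ℂ, Continuous f → Continuous fun x => qPoch (f x) q k := fun f hf =>
    (continuous_qPoch q k).comp hf
  refine ContinuousAt.mul (ContinuousAt.div ?_ ?_ ?_) continuousAt_const
  · exact ((continuous_const.mul (hp _ (by fun_prop))).mul (hp _ (by fun_prop))).continuousAt
  · exact ((continuous_const.mul (hp _ (by fun_prop))).mul (hp _ (by fun_prop))).continuousAt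
  · refine mul_ne_zero (mul_ne_zero (qPoch_ne_zero (ofReal_mul_pow_self_ne_one hq0 hq1) k)
      (qPoch_ne_zero (fun j => by exact_mod_cast hαξ j) k)) (qPoch_ne_zero (fun j => ?_) k)
    have := ofReal_mul_pow_ne_one_of_neg hq0
      (div_neg_of_neg_of_pos (mul_neg_of_pos_of_neg hq0 hξ) hβ) j
    exact_mod_cast this

/-- The expansion with remainder after `N` terms. -/
theorem thetaQuot_eq_partialExpansion_add (hq0 : 0 < q) (hq1 : q < 1) (hβ : 0 < β) (hξ : ξ < 0)
    (hαξ : ∀ n : ℕ, α * ξ * q ^ n ≠ 1) {m N : ℕ} (hm : |α * q ^ m| ≤ β) (hN : m + 2 ≤ N)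
    {u : ℂ} (hu : u.re < 0) :
    Integrable (fun s : ℝ => remainderKernel q α β ξ N u (s * I)) ∧
      thetaQuot q α β u = partialExpansion q α β ξ N u +
        nodePoly q ξ N u * (1 / (4 * Real.pi) *
          ∫ s : ℝ, remainderKernel q α β ξ N u (s * I)) := by
  have hq := norm_ofReal_lt_one hq0 hq1
  have hdense := dense_distinct_nodes hq0 α
  -- An admissible y in (ξ, 0) has smaller node products on the imaginary axis, so its integrable
  -- kernel dominates those of ξ and of all x < y.
  obtain ⟨y, hy, hξy, hy0⟩ := hdense.exists_between hξ
  have hbound := (thetaQuot_eq_of_distinct hq0 hq1 hβ hy0 hy.2 hy.1 hm hN hu).1.norm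
  have hmeas : ∀ x : ℝ, AEStronglyMeasurable
      (fun s : ℝ => remainderKernel q α β x N u (s * I)) volume := fun x =>
    ((measurable_remainderKernel hq α β x N u).comp measurable_ofReal_mul_I).aestronglyMeasurable
  refine ⟨hbound.mono' (hmeas ξ) (.of_forall fun s =>
    norm_remainderKernel_le_of_le hq0 α β hξy.le hy0.le N u s), ?_⟩
  set S := {x : ℝ | (∀ n : ℕ, x ^ 2 * q ^ n ≠ 1) ∧ ∀ n : ℕ, α * x * q ^ n ≠ 1} with hS
  have hbot : (𝓝[S] ξ).NeBot := mem_closure_iff_nhdsWithin_neBot.1 (hdense ξ)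
  have hlt : ∀ᶠ x in 𝓝[S] ξ, x < y := mem_nhdsWithin_of_mem_nhds (Iio_mem_nhds hξy)
  have hnode : ∀ v : ℂ, Tendsto (fun x : ℝ => nodePoly q x N v) (𝓝[S] ξ)
      (𝓝 (nodePoly q ξ N v)) := fun v => by
    refine (Continuous.tendsto ?_ ξ).mono_left nhdsWithin_le_nhds
    unfold nodePoly qPoch
    fun_prop
  have hint : Tendsto (fun x : ℝ => ∫ s : ℝ, remainderKernel q α β x N u (s * I)) (𝓝[S] ξ)
      (𝓝 (∫ s : ℝ, remainderKernel q α β ξ N u (s * I))) := by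
    refine tendsto_integral_filter_of_dominated_convergence _ (.of_forall hmeas) ?_ hbound
      (.of_forall fun s => ?_)
    · filter_upwards [hlt] with x hx
      exact .of_forall fun s => norm_remainderKernel_le_of_le hq0 α β hx.le hy0.le N u s
    · exact (tendsto_const_nhds.div (hnode _)
        (nodePoly_ne_zero hq0 hξ.le (by simp) N)).mul_const _
  have hlim := ((continuousAt_partialExpansion hq0 hq1 hβ hξ hαξ N u).tendsto.mono_left
    (nhdsWithin_le_nhds (s := S))).add ((hnode u).mul (hint.const_mul (1 / (4 * (Real.pi : ℂ)))))
  refine tendsto_nhds_unique (tendsto_const_nhds.congr' ?_) hlim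
  filter_upwards [hlt, self_mem_nhdsWithin] with x hx hxS
  exact (thetaQuot_eq_of_distinct hq0 hq1 hβ (hx.trans hy0) hxS.2 hxS.1 hm hN hu).2

/-! ### Passage to infinitely many terms -/

/-- The coefficient of z^k converges to a quotient of infinite products, so the series is dominated
by a geometric one. -/
lemma summable_phi32Term {a b c d e q z : ℂ} (hq : ‖q‖ < 1) (hz : ‖z‖ < 1)
    (hqq : ∀ j : ℕ, q * q ^ j ≠ 1) (hd : ∀ j : ℕ, d * q ^ j ≠ 1) (he : ∀ j : ℕ, e * q ^ j ≠ 1) :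
    Summable (phi32Term a b c d e q z) := by
  have h : Tendsto (fun k => (qPoch a q k * qPoch b q k * qPoch c q k) /
      (qPoch q q k * qPoch d q k * qPoch e q k)) atTop
      (𝓝 ((qPochInf a q * qPochInf b q * qPochInf c q) /
        (qPochInf q q * qPochInf d q * qPochInf e q))) :=
    (((tendsto_qPoch a hq).mul (tendsto_qPoch b hq)).mul (tendsto_qPoch c hq)).div
      (((tendsto_qPoch q hq).mul (tendsto_qPoch d hq)).mul (tendsto_qPoch e hq))
      (mul_ne_zero (mul_ne_zero (qPochInf_ne_zero hq hqq) (qPochInf_ne_zero hq hd))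
        (qPochInf_ne_zero hq he))
  have hO : phi32Term a b c d e q z =O[atTop] fun k : ℕ => ‖z‖ ^ k := by
    have := (h.isBigO_one ℝ).mul (Asymptotics.isBigO_refl (fun k : ℕ => z ^ k) atTop).norm_right
    simp only [one_mul, norm_pow] at this
    exact this
  exact summable_of_isBigO_nat (summable_geometric_of_lt_one (norm_nonneg z) hz) hO

/-- The limit of `remainderKernel` as the number of terms tends to infinity. -/
noncomputable def remainderKernelInf (q α β ξ u v : ℂ) : ℂ :=
  thetaQuot q α β v / (qPochInf (ξ * v) q * qPochInf (ξ / v) q) * symmKernel u v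

lemma remainderIntegrand_eq (q α β ξ u v : ℂ) :
    remainderIntegrand q α β ξ u v =
      qPochInf (ξ * u) q * qPochInf (ξ / u) q * remainderKernelInf q α β ξ u v := by
  simp only [remainderIntegrand, remainderKernelInf, thetaQuot, symmKernel, div_eq_mul_inv, mul_inv]
  ring

end RealParameters

end QSeries

open QSeries Filter Topology MeasureTheory
theorem mainTheorem5 (q α β ξ : ℝ) (hq0 : 0 < q) (hq1 : q < 1) (hβ : 0 < β) (hξ : ξ < 0)
    (hαξ : ∀ n : ℕ, α * ξ * q ^ n ≠ 1) (u : ℂ) (hu : u.re < 0) :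
    Summable (QSeries.phi32Term (α / β) (ξ * u) (ξ / u) (α * ξ) (q * ξ / β) q q) ∧
    QSeries.IntegrableOnImagAxis (QSeries.remainderIntegrand q α β ξ u) ∧
    (QSeries.qPochInf (α * u) q * QSeries.qPochInf (α / u) q) /
        (QSeries.qPochInf (β * u) q * QSeries.qPochInf (β / u) q) =
      (QSeries.qPochInf (α * ξ) q * QSeries.qPochInf (α / ξ) q) /
          (QSeries.qPochInf (β * ξ) q * QSeries.qPochInf (β / ξ) q) *
        QSeries.phi32 (α / β) (ξ * u) (ξ / u) (α * ξ) (q * ξ / β) q q +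
      1 / (4 * Real.pi * Complex.I) *
        QSeries.imagAxisIntegral (QSeries.remainderIntegrand q α β ξ u) := by
  have hq := norm_ofReal_lt_one hq0 hq1
  have hsum : Summable (phi32Term (α / β) (ξ * u) (ξ / u) (α * ξ) (q * ξ / β) q q) := by
    refine summable_phi32Term hq hq (ofReal_mul_pow_self_ne_one hq0 hq1)
      (fun j => by exact_mod_cast hαξ j) fun j => ?_
    have := ofReal_mul_pow_ne_one_of_neg hq0
      (div_neg_of_neg_of_pos (mul_neg_of_pos_of_neg hq0 hξ) hβ) j
    exact_mod_cast this
  obtain ⟨m, hm⟩ := exists_abs_mul_pow_le hq0 hq1 α hβ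
  have hfin := fun n : ℕ => thetaQuot_eq_partialExpansion_add hq0 hq1 hβ hξ hαξ hm
    (Nat.le_add_right (m + 2) n) hu
  -- The kernel with m + 2 terms, the fewest for which the finite expansion is established,
  -- dominates all later ones.
  have hbound := (hfin 0).1.norm
  have hmeas : ∀ n : ℕ, AEStronglyMeasurable
      (fun s : ℝ => remainderKernel q α β ξ (m + 2 + n) u (s * Complex.I)) volume := fun n =>
    (hfin n).1.aestronglyMeasurable
  have hshift : Tendsto (fun n : ℕ => m + 2 + n) atTop atTop :=
    tendsto_atTop_mono (fun n => Nat.le_add_left n _) tendsto_id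
  have hnode : ∀ v : ℂ, Tendsto (fun n : ℕ => nodePoly q ξ (m + 2 + n) v) atTop
      (𝓝 (qPochInf (ξ * v) q * qPochInf (ξ / v) q)) := fun v =>
    ((tendsto_qPoch _ hq).mul (tendsto_qPoch _ hq)).comp hshift
  have hne : ∀ s : ℝ, qPochInf (ξ * (s * Complex.I)) q * qPochInf (ξ / (s * Complex.I)) q ≠ 0 := by
    intro s
    have h1 : 1 ≤ ‖qPochInf (ξ * (s * Complex.I)) q * qPochInf (ξ / (s * Complex.I)) q‖ :=
      ge_of_tendsto' (hnode (s * Complex.I)).norm fun n =>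
        one_le_norm_nodePoly hq0 hξ.le (by simp) _
    exact norm_pos_iff.1 (one_pos.trans_le h1)
  have hpt : ∀ s : ℝ, Tendsto
      (fun n : ℕ => remainderKernel q α β ξ (m + 2 + n) u (s * Complex.I)) atTop
      (𝓝 (remainderKernelInf q α β ξ u (s * Complex.I))) := fun s =>
    (tendsto_const_nhds.div (hnode _) (hne s)).mul_const _
  have hle : ∀ (n : ℕ) (s : ℝ), ‖remainderKernel q α β ξ (m + 2 + n) u (s * Complex.I)‖ ≤
      ‖remainderKernel q α β ξ (m + 2 + 0) u (s * Complex.I)‖ := fun n s =>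
    norm_remainderKernel_le_of_add hq0 α β hξ.le (m + 2) n u s
  have hint : Integrable fun s : ℝ => remainderKernelInf q α β ξ u (s * Complex.I) :=
    hbound.mono' (aestronglyMeasurable_of_tendsto_ae atTop hmeas (.of_forall hpt))
      (.of_forall fun s => le_of_tendsto' (hpt s).norm fun n => hle n s)
  have hlimint := tendsto_integral_of_dominated_convergence _ hmeas hbound
    (fun n => .of_forall (hle n)) (.of_forall hpt)
  have hlimsum : Tendsto (fun n : ℕ => partialExpansion q α β ξ (m + 2 + n) u) atTop
      (𝓝 (thetaQuot q α β ξ * phi32 (α / β) (ξ * u) (ξ / u) (α * ξ) (q * ξ / β) q q)) :=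
    (hsum.hasSum.tendsto_sum_nat.comp hshift).const_mul _
  have hmain := tendsto_nhds_unique (tendsto_const_nhds.congr fun n => (hfin n).2)
    (hlimsum.add ((hnode u).mul (hlimint.const_mul (1 / (4 * (Real.pi : ℂ))))))
  refine ⟨hsum, ?_, ?_⟩
  · simp only [IntegrableOnImagAxis, remainderIntegrand_eq]
    exact hint.const_mul _
  · change thetaQuot q α β u = thetaQuot q α β ξ * _ + _
    rw [hmain, imagAxisIntegral, integral_mul_const]
    simp only [remainderIntegrand_eq]
    rw [integral_const_mul]
    have hpi : (Real.pi : ℂ) ≠ 0 := by exact_mod_cast Real.pi_ne_zero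
    congr 1
    generalize ∫ s : ℝ, remainderKernelInf q α β ξ u (s * Complex.I) = J
    have hI := Complex.I_ne_zero
    field_simp
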